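/- **Setting.** Let $d\in\{2,3\}$ and let $\Omega\subset\mathbb R^d$ be a bounded domain (no regularity of $\partial\Omega$ is needed; for a Lipschitz boundary the spaces below are the usual ones with zero trace, resp. zero normal trace). Put $X=H_0^1(\Omega)^d$, $Y=H_0(\mathrm{div},\Omega)$, $E=S=L_0^2(\Omega)$ (functions in $L^2$ with mean zero), $Z=H_0^1(\Omega)$, where $H_0^1(\Omega)$ and $H_0(\mathrm{div},\Omega)$ are the closures of $C_c^\infty(\Omega)$, resp. $C_c^\infty(\Omega)^d$, in $H^1(\Omega)$, resp. $H(\mathrm{div},\Omega)$. Let $(\cdot,\cdot)$ and $\|\cdot\|_0$ be the inner product and norm of $L^2(\Omega)$, and $$\|K\|_{\mathrm{div}}=(\|K\|_0^2+\|\nabla\cdot K\|_0^2)^{1/2},\qquad \|(v,K)\|_1=(\|\nabla v\|_0^2+\|K\|_{\mathrm{div}}^2)^{1/2}.$$ Let $Pr>0$, $Ra\ge 0$, $\kappa>0$, let $\mathbf i\in\mathbb R^d$ be a unit vector and $B\in L^3(\Omega)^3$; for $d=2$ vectors of $\mathbb R^2$ are regarded as vectors $(x_1,x_2,0)$ of $\mathbb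 R^3$ (so that only $B_3$ matters). Let $f\in H^{-1}(\Omega)^d$, $g\in L^2(\Omega)^d$, $\varphi\in H^{-1}(\Omega)$ and $$\|f\|_{-1}=\sup_{0\ne v\in X}\frac{\langle f,v\rangle}{\|\nabla v\|_0},\quad \|L\|_*=(\|f\|_{-1}^2+\kappa^2\|g\|_0^2)^{1/2},\quad \lambda_\psi=\|\varphi\|_{-1}=\sup_{0\ne r\in Z}\frac{\langle\varphi,r\rangle}{\|\nabla r\|_0}.$$ Let $\lambda_2$ and $C_\Omega$ be the smallest nonnegative constants such that $\|w\|_{L^4(\Omega)}^2\le\lambda_2\|\nabla w\|_0^2$ and $\|w\|_0\le C_\Omega\|\nabla w\|_0$ for all $w\in X$ and all $w\in Z$. Put $\lambda_q=Pr\,Ra\,C_\Omega^2$, $C_{\min}=\min\{Pr,\kappa\}$ and $$\sigma=\frac{\lambda_2\|L\|_*}{C_{\min}^2}+\frac{\lambda_2\lambda_q\lambda_\psi}{C_{\min}^2}+\frac{\lambda_2\lambda_q\lambda_\psi}{C_{\min}}+\frac{\lambda_2\|L\|_*}{C_{\min}}.$$ **Discrete problem.** Let $X_h\subseteq X$, $Y_h\subseteq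 Y$, $E_h\subseteq E$, $S_h\subseteq S$, $Z_h\subseteq Z$ be finite-dimensional subspaces with $\nabla\cdot K_h\in S_h$ for all $K_h\in Y_h$. Write $b_s(q,v)=-Pr(q,\nabla\cdot v)$, $b_m(\psi,K)=-\kappa(\psi,\nabla\cdot K)$ and assume that there are constants $\beta_s,\beta_m>0$ with $$\inf_{0\ne q\in E_h}\ \sup_{0\ne w\in X_h}\frac{b_s(q,w)}{\|\nabla w\|_0\|q\|_0}\ge\beta_s,\qquad \inf_{0\ne\psi\in S_h}\ \sup_{0\ne K\in Y_h}\frac{b_m(\psi,K)}{\|K\|_{\mathrm{div}}\|\psi\|_0}\ge\beta_m .$$ The discrete problem is: find $(u_h,J_h,p_h,\phi_h,\theta_h)\in X_h\times Y_h\times E_h\times S_h\times Z_h$ such that for all $(v,K,q,\psi,r)\in X_h\times Y_h\times E_h\times S_h\times Z_h$ $$\begin{aligned} &Pr(\nabla u_h,\nabla v)+\kappa(J_h,K)-\kappa(J_h\times B,v)+\kappa(K\times B,u_h)+\tfrac12((u_h\cdot\nabla)u_h,v)-\tfrac12((u_h\cdot\nabla)v,u_h)\\ &\qquad+b_s(p_h,v)+b_m(\phi_h,K)-Pr\,Ra\,(\theta_h\mathbf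 i,v)=\langle f,v\rangle+\kappa(g,K),\\ &b_s(q,u_h)+b_m(\psi,J_h)=0,\\ &(\nabla\theta_h,\nabla r)+\tfrac12(u_h\cdot\nabla\theta_h,r)-\tfrac12(u_h\cdot\nabla r,\theta_h)=\langle\varphi,r\rangle . \end{aligned}$$ **Theorem.** If $\sigma<1$, then the discrete problem is well-posed: it has exactly one solution, and the solution depends continuously on $(f,g,\varphi)$, i.e. for every $\varepsilon>0$ there is $\delta>0$ such that every solution $(u_h',J_h',p_h',\phi_h',\theta_h')$ of the discrete problem for data $(f',g',\varphi')$ with $\|f'-f\|_{-1}<\delta$, $\|g'-g\|_0<\delta$, $\|\varphi'-\varphi\|_{-1}<\delta$ satisfies $$\|(u_h'-u_h,J_h'-J_h)\|_1+\|p_h'-p_h\|_0+\|\phi_h'-\phi_h\|_0+\|\nabla(\theta_h'-\theta_h)\|_0<\varepsilon .$$ Moreover, the solution obeys $$\|(u_h,J_h)\|_1\le\frac{\|L\|_*+\lambda_q\lambda_\psi}{C_{\min}},\qquad \|\nabla\theta_h\|_0\le\lambda_\psi .$$ -/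

import Mathlib

open MeasureTheory
open scoped ContDiff ENNReal Matrix

noncomputable section

namespace IMHD

/-! ### Function spaces on an open set `Ω ⊆ ℝ^d` -/

/-- The Euclidean space `ℝ^d`. -/
abbrev Pt (d : ℕ) : Type := EuclideanSpace ℝ (Fin d)

/-- `L²(Ω; F)`. -/
abbrev L2 {d : ℕ} (Ω : Set (Pt d)) (F : Type) [NormedAddCommGroup F] : Type :=
  Lp F 2 (volume.restrict Ω)

/-- `f ∈ C_c^∞(Ω; F)`. -/
def IsTestFunction {d : ℕ} (Ω : Set (Pt d)) {F : Type} [NormedAddCommGroup F] [NormedSpace ℝ F]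
    (f : Pt d → F) : Prop :=
  ContDiff ℝ ∞ f ∧ HasCompactSupport f ∧ tsupport f ⊆ Ω

/-- The classical divergence of a vector field. -/
def divergence {d : ℕ} (Φ : Pt d → Pt d) (x : Pt d) : ℝ :=
  ∑ i, (fderiv ℝ Φ x (EuclideanSpace.single i 1)) i

/-- The pairs `(φ, ∇φ)` with `φ ∈ C_c^∞(Ω)`, as elements of `L²(Ω) × L²(Ω)^d`. -/
def testGradPairs {d : ℕ} (Ω : Set (Pt d)) : Set (L2 Ω ℝ × L2 Ω (Pt d)) :=
  {z | ∃ φ : Pt d → ℝ, IsTestFunction Ω φ ∧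
    z.1 =ᵐ[volume.restrict Ω] φ ∧ z.2 =ᵐ[volume.restrict Ω] gradient φ}

/-- The pairs `(Φ, ∇·Φ)` with `Φ ∈ C_c^∞(Ω)^d`, as elements of `L²(Ω)^d × L²(Ω)`. -/
def testDivPairs {d : ℕ} (Ω : Set (Pt d)) : Set (L2 Ω (Pt d) × L2 Ω ℝ) :=
  {z | ∃ Φ : Pt d → Pt d, IsTestFunction Ω Φ ∧
    z.1 =ᵐ[volume.restrict Ω] Φ ∧ z.2 =ᵐ[volume.restrict Ω] divergence Φ}

/-- `H¹(Ω)`. A function `r` is stored together with its weak gradient `G` (which `r` determines):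
`(r, ∇·Φ) + (G, Φ) = 0` for all `Φ ∈ C_c^∞(Ω)^d`. The topology inherited from the product is that
of the `H¹` norm. -/
def H1 {d : ℕ} (Ω : Set (Pt d)) : Submodule ℝ (L2 Ω ℝ × L2 Ω (Pt d)) where
  carrier := {z | ∀ t ∈ testDivPairs Ω, inner ℝ z.1 t.2 + inner ℝ z.2 t.1 = 0}
  zero_mem' := by intro t _; simp
  add_mem' := by
    intro a b ha hb t ht
    have h1 := ha t ht
    have h2 := hb t ht
    simp only [Prod.fst_add, Prod.snd_add, inner_add_left]
    linarith
  smul_mem' := by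
    intro c a ha t ht
    have h1 := ha t ht
    simp only [Prod.smul_fst, Prod.smul_snd, real_inner_smul_left]
    rw [← mul_add, h1, mul_zero]

/-- `H(div, Ω)`. A field `K` is stored together with its weak divergence `D` (which `K` determines):
`(K, ∇φ) + (D, φ) = 0` for all `φ ∈ C_c^∞(Ω)`. -/
def HDiv {d : ℕ} (Ω : Set (Pt d)) : Submodule ℝ (L2 Ω (Pt d) × L2 Ω ℝ) where
  carrier := {z | ∀ t ∈ testGradPairs Ω, inner ℝ z.1 t.2 + inner ℝ z.2 t.1 = 0}
  zero_mem' := by intro t _; simp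
  add_mem' := by
    intro a b ha hb t ht
    have h1 := ha t ht
    have h2 := hb t ht
    simp only [Prod.fst_add, Prod.snd_add, inner_add_left]
    linarith
  smul_mem' := by
    intro c a ha t ht
    have h1 := ha t ht
    simp only [Prod.smul_fst, Prod.smul_snd, real_inner_smul_left]
    rw [← mul_add, h1, mul_zero]

/-- `H₀¹(Ω)`: the closure of `C_c^∞(Ω)` in `H¹(Ω)`. -/
def H10 {d : ℕ} (Ω : Set (Pt d)) : Submodule ℝ (L2 Ω ℝ × L2 Ω (Pt d)) :=
  H1 Ω ⊓ (Submodule.span ℝ (testGradPairs Ω)).topologicalClosure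

/-- `H₀(div, Ω)`: the closure of `C_c^∞(Ω)^d` in `H(div, Ω)`. -/
def HDiv0 {d : ℕ} (Ω : Set (Pt d)) : Submodule ℝ (L2 Ω (Pt d) × L2 Ω ℝ) :=
  HDiv Ω ⊓ (Submodule.span ℝ (testDivPairs Ω)).topologicalClosure

/-- `L₀²(Ω)`: the functions `q ∈ L²(Ω)` with `∫_Ω q = 0` (integrability is automatic when `Ω` is
bounded). -/
def L20 {d : ℕ} (Ω : Set (Pt d)) : Submodule ℝ (L2 Ω ℝ) where
  carrier := {q | Integrable q (volume.restrict Ω) ∧ ∫ x in Ω, q x = 0}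
  zero_mem' := by
    have h := Lp.coeFn_zero ℝ 2 (volume.restrict Ω)
    refine ⟨(integrable_zero _ _ _).congr h.symm, ?_⟩
    rw [integral_congr_ae h]
    simp
  add_mem' := by
    rintro a b ⟨hai, ha⟩ ⟨hbi, hb⟩
    have h := Lp.coeFn_add a b
    refine ⟨(hai.add hbi).congr h.symm, ?_⟩
    rw [integral_congr_ae h]
    simp only [Pi.add_apply]
    rw [integral_add hai hbi, ha, hb, add_zero]
  smul_mem' := by
    rintro c a ⟨hai, ha⟩
    have h := Lp.coeFn_smul c a
    refine ⟨(hai.smul c).congr h.symm, ?_⟩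
    rw [integral_congr_ae h]
    simp only [Pi.smul_apply]
    rw [integral_smul, ha, smul_zero]

/-- The temperature space `Z = H₀¹(Ω)`. -/
abbrev SpZ {d : ℕ} (Ω : Set (Pt d)) : Type := H10 Ω

/-- The velocity space `X = H₀¹(Ω)^d`. -/
abbrev SpX {d : ℕ} (Ω : Set (Pt d)) : Type := Fin d → H10 Ω

/-- The current density space `Y = H₀(div, Ω)`. -/
abbrev SpY {d : ℕ} (Ω : Set (Pt d)) : Type := HDiv0 Ω

section fields

variable {d : ℕ} {Ω : Set (Pt d)}

/-- The underlying function of `r ∈ H₀¹(Ω)`. -/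
def fn (r : SpZ Ω) : L2 Ω ℝ := r.1.1

/-- The weak gradient of `r ∈ H₀¹(Ω)`. -/
def grad (r : SpZ Ω) : L2 Ω (Pt d) := r.1.2

/-- The vector field of `v ∈ H₀¹(Ω)^d`. -/
def vec (v : SpX Ω) (x : Pt d) : Pt d := WithLp.toLp 2 (fun i => fn (v i) x)

/-- The weak divergence `∑ᵢ ∂ᵢ vᵢ` of `v ∈ H₀¹(Ω)^d`. -/
def divX (v : SpX Ω) (x : Pt d) : ℝ := ∑ i, (grad (v i) x) i

/-- The vector field of `K ∈ H₀(div, Ω)`. -/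
def fld (K : SpY Ω) : L2 Ω (Pt d) := K.1.1

/-- The weak divergence of `K ∈ H₀(div, Ω)`. -/
def divY (K : SpY Ω) : L2 Ω ℝ := K.1.2

/-- `‖∇v‖₀` for `v ∈ H₀¹(Ω)^d`. -/
def gradNorm (v : SpX Ω) : ℝ := √(∑ i, ‖grad (v i)‖ ^ 2)

/-- `‖K‖_div = (‖K‖₀² + ‖∇·K‖₀²)^{1/2}`. -/
def divNorm (K : SpY Ω) : ℝ := √(‖fld K‖ ^ 2 + ‖divY K‖ ^ 2)

/-- The energy norm `‖(v, K)‖₁ = (‖∇v‖₀² + ‖K‖_div²)^{1/2}`. -/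
def energyNorm (v : SpX Ω) (K : SpY Ω) : ℝ := √(gradNorm v ^ 2 + divNorm K ^ 2)

/-- `‖f‖₋₁` for `f ∈ H⁻¹(Ω)^d`, the dual of `H₀¹(Ω)^d`. -/
def dualNormX (f : SpX Ω →L[ℝ] ℝ) : ℝ := ⨆ v : {v : SpX Ω // v ≠ 0}, f v.1 / gradNorm v.1

/-- `‖ϕ‖₋₁` for `ϕ ∈ H⁻¹(Ω)`, the dual of `H₀¹(Ω)`. -/
def dualNormZ (ϕ : SpZ Ω →L[ℝ] ℝ) : ℝ := ⨆ r : {r : SpZ Ω // r ≠ 0}, ϕ r.1 / ‖grad r.1‖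

end fields

/-- The embedding constant `λ₂`: the smallest `c ≥ 0` with `‖v‖_{L⁴}² ≤ c ‖∇v‖₀²` for all
`v ∈ H₀¹(Ω)^d` and `‖r‖_{L⁴}² ≤ c ‖∇r‖₀²` for all `r ∈ H₀¹(Ω)`. -/
def lam2 {d : ℕ} (Ω : Set (Pt d)) : ℝ :=
  sInf {c : ℝ | 0 ≤ c ∧
    (∀ v : SpX Ω, eLpNorm (vec v) 4 (volume.restrict Ω) ^ 2 ≤ ENNReal.ofReal (c * gradNorm v ^ 2)) ∧
    (∀ r : SpZ Ω, eLpNorm (fn r) 4 (volume.restrict Ω) ^ 2 ≤ ENNReal.ofReal (c * ‖grad r‖ ^ 2))}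

/-- The Poincaré constant `C_Ω`: the smallest `c ≥ 0` with `‖v‖₀ ≤ c ‖∇v‖₀` for all
`v ∈ H₀¹(Ω)^d` and `‖r‖₀ ≤ c ‖∇r‖₀` for all `r ∈ H₀¹(Ω)`. -/
def cOmega {d : ℕ} (Ω : Set (Pt d)) : ℝ :=
  sInf {c : ℝ | 0 ≤ c ∧
    (∀ v : SpX Ω, eLpNorm (vec v) 2 (volume.restrict Ω) ≤ ENNReal.ofReal (c * gradNorm v)) ∧
    (∀ r : SpZ Ω, ‖fn r‖ ≤ c * ‖grad r‖)}

/-! ### The data of the problem -/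

/-- The coefficients: Prandtl number, Rayleigh number, coupling number, the direction `𝐢` of
buoyancy and the applied magnetic field. For `d = 2` the field is `(0, 0, B₃)`; only its third
component enters the equations then. -/
structure Params (d : ℕ) where
  Pr : ℝ
  Ra : ℝ
  kappa : ℝ
  dir : Pt d
  B : Pt d → EuclideanSpace ℝ (Fin 3)

/-- The sources `f ∈ H⁻¹(Ω)^d`, `g ∈ L²(Ω)^d`, `φ ∈ H⁻¹(Ω)`. -/
structure Source {d : ℕ} (Ω : Set (Pt d)) where
  f : SpX Ω →L[ℝ] ℝ
  g : L2 Ω (Pt d)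
  heat : SpZ Ω →L[ℝ] ℝ

/-- A vector of `ℝ^d`, `d ≤ 3`, seen in `ℝ³`: missing components are zero. -/
def pad {d : ℕ} (v : Pt d) : Fin 3 → ℝ := fun i => if h : (i : ℕ) < d then v ⟨i, h⟩ else 0

section constants

variable {d : ℕ} {Ω : Set (Pt d)} (P : Params d) (D : Source Ω)

/-- `‖L‖_* = (‖f‖₋₁² + κ² ‖g‖₀²)^{1/2}`. -/
def normL : ℝ := √(dualNormX D.f ^ 2 + P.kappa ^ 2 * ‖D.g‖ ^ 2)

/-- `λ_ψ = ‖φ‖₋₁`. -/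
def lamPsi : ℝ := dualNormZ D.heat

variable (Ω) in
/-- `λ_q = Pr Ra C_Ω²`. -/
def lamQ : ℝ := P.Pr * P.Ra * cOmega Ω ^ 2

/-- `C_min = min {Pr, κ}`. -/
def cMin : ℝ := min P.Pr P.kappa

/-- The number `σ`. -/
def sigma : ℝ :=
  lam2 Ω * normL P D / cMin P ^ 2 + lam2 Ω * lamQ Ω P * lamPsi D / cMin P ^ 2
    + lam2 Ω * lamQ Ω P * lamPsi D / cMin P + lam2 Ω * normL P D / cMin P

end constants

/-! ### The forms -/

section forms

variable {d : ℕ} {Ω : Set (Pt d)} (P : Params d) (D : Source Ω)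

/-- `a_s(v, w) = Pr (∇v, ∇w)`. -/
def aS (v w : SpX Ω) : ℝ := P.Pr * ∑ i, inner ℝ (grad (v i)) (grad (w i))

/-- `a_m(F, K) = κ (F, K)`. -/
def aM (F K : SpY Ω) : ℝ := P.kappa * inner ℝ (fld F) (fld K)

/-- `d(K, v) = -κ (K × B, v)`. -/
def dForm (K : SpY Ω) (v : SpX Ω) : ℝ :=
  -P.kappa * ∫ x in Ω, (pad (fld K x) ⨯₃ (P.B x).ofLp) ⬝ᵥ pad (vec v x)

/-- `b_s(q, v) = -Pr (q, ∇·v)`. -/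
def bS (q : L2 Ω ℝ) (v : SpX Ω) : ℝ := -P.Pr * ∫ x in Ω, q x * divX v x

/-- `b_m(ψ, K) = -κ (ψ, ∇·K)`. -/
def bM (ψ : L2 Ω ℝ) (K : SpY Ω) : ℝ := -P.kappa * inner ℝ ψ (divY K)

/-- `((u·∇)v, w)`. -/
def convX (u v w : SpX Ω) : ℝ :=
  ∫ x in Ω, ∑ i, inner ℝ (vec u x) (grad (v i) x) * fn (w i) x

/-- `((u·∇)θ, r)`. -/
def convZ (u : SpX Ω) (θ r : SpZ Ω) : ℝ := ∫ x in Ω, inner ℝ (vec u x) (grad θ x) * fn r x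

/-- `𝒜₀((u, J), (v, K))`. -/
def formA0 (u : SpX Ω) (J : SpY Ω) (v : SpX Ω) (K : SpY Ω) : ℝ :=
  aS P u v + aM P J K + dForm P J v - dForm P K u

/-- `𝒜₁((w, M), (u, J), (v, K)) = c(w, u, v)`, which does not depend on `M, J, K`. -/
def formA1 (w u v : SpX Ω) : ℝ := 1 / 2 * convX w u v - 1 / 2 * convX w v u

/-- `ℬ((q, ψ), (v, K))`. -/
def formB (q ψ : L2 Ω ℝ) (v : SpX Ω) (K : SpY Ω) : ℝ := bS P q v + bM P ψ K

/-- `𝒬(θ, (v, K)) = -Pr Ra (𝐢 θ, v)`, which does not depend on `K`. -/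
def formQ (θ : SpZ Ω) (v : SpX Ω) : ℝ :=
  -(P.Pr * P.Ra) * ∫ x in Ω, inner ℝ (fn θ x • P.dir) (vec v x)

/-- `e(θ, r) = (∇θ, ∇r)`. -/
def formE (θ r : SpZ Ω) : ℝ := inner ℝ (grad θ) (grad r)

/-- `ℋ((u, J), θ, r) = h(u, θ, r)`, which does not depend on `J`. -/
def formH (u : SpX Ω) (θ r : SpZ Ω) : ℝ := 1 / 2 * convZ u θ r - 1 / 2 * convZ u r θ

/-- `⟨L, (v, K)⟩ = ⟨f, v⟩ + κ (g, K)`. -/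
def formL (v : SpX Ω) (K : SpY Ω) : ℝ := D.f v + P.kappa * inner ℝ D.g (fld K)

end forms

/-! ### The discrete problem -/

/-- The inf-sup condition
`inf_{0 ≠ q ∈ M} sup_{0 ≠ w ∈ W} b(q, w) / (‖w‖_W ‖q‖_M) ≥ β`. The infimum and the supremum are
taken in the extended reals. -/
def InfSup {M W : Type*} [Zero M] [Zero W] (b : M → W → ℝ) (nM : M → ℝ) (nW : W → ℝ)
    (β : ℝ) : Prop :=
  (β : EReal) ≤ ⨅ q : {q : M // q ≠ 0}, ⨆ w : {w : W // w ≠ 0},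
    ((b q.1 w.1 / (nW w.1 * nM q.1) : ℝ) : EReal)

/-- Subspaces `X_h ⊆ X`, `Y_h ⊆ Y`, `E_h ⊆ L₀²(Ω)`, `S_h ⊆ L₀²(Ω)`, `Z_h ⊆ Z`. -/
structure Spaces {d : ℕ} (Ω : Set (Pt d)) where
  Xh : Submodule ℝ (SpX Ω)
  Yh : Submodule ℝ (SpY Ω)
  Eh : Submodule ℝ (L20 Ω)
  Sh : Submodule ℝ (L20 Ω)
  Zh : Submodule ℝ (SpZ Ω)

section discrete

variable {d : ℕ} {Ω : Set (Pt d)}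

/-- All five spaces are finite-dimensional. -/
def Spaces.IsFinite (V : Spaces Ω) : Prop :=
  FiniteDimensional ℝ V.Xh ∧ FiniteDimensional ℝ V.Yh ∧ FiniteDimensional ℝ V.Eh ∧
    FiniteDimensional ℝ V.Sh ∧ FiniteDimensional ℝ V.Zh

/-- `∇·K_h ∈ S_h` for all `K_h ∈ Y_h`. -/
def Spaces.DivCompatible (V : Spaces Ω) : Prop :=
  ∀ K ∈ V.Yh, ∃ ψ ∈ V.Sh, (ψ : L2 Ω ℝ) = divY K

/-- The velocity-pressure inf-sup condition with constant `β`. -/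
def Spaces.InfSupS (P : Params d) (V : Spaces Ω) (β : ℝ) : Prop :=
  InfSup (fun (q : V.Eh) (w : V.Xh) => bS P (q.1 : L2 Ω ℝ) w.1)
    (fun q => ‖(q.1 : L2 Ω ℝ)‖) (fun w => gradNorm w.1) β

/-- The current-potential inf-sup condition with constant `β`. -/
def Spaces.InfSupM (P : Params d) (V : Spaces Ω) (β : ℝ) : Prop :=
  InfSup (fun (ψ : V.Sh) (K : V.Yh) => bM P (ψ.1 : L2 Ω ℝ) K.1)
    (fun ψ => ‖(ψ.1 : L2 Ω ℝ)‖) (fun K => divNorm K.1) β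

/-- The unknowns `(u_h, J_h, p_h, φ_h, θ_h) ∈ X_h × Y_h × E_h × S_h × Z_h`. -/
structure State (V : Spaces Ω) where
  u : V.Xh
  J : V.Yh
  p : V.Eh
  pot : V.Sh
  temp : V.Zh

/-- `s` solves the discrete problem. -/
def IsSolution (P : Params d) (D : Source Ω) (V : Spaces Ω) (s : State V) : Prop :=
  (∀ (v : V.Xh) (K : V.Yh),
    formA0 P s.u.1 s.J.1 v.1 K.1 + formA1 s.u.1 s.u.1 v.1 + formB P s.p.1 s.pot.1 v.1 K.1
      + formQ P s.temp.1 v.1 = formL P D v.1 K.1) ∧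
  (∀ (q : V.Eh) (ψ : V.Sh), formB P q.1 ψ.1 s.u.1 s.J.1 = 0) ∧
  (∀ r : V.Zh, formE s.temp.1 r.1 + formH s.u.1 s.temp.1 r.1 = D.heat r.1)

/-- The distance of two states in the norms of the problem. -/
def State.dist {V : Spaces Ω} (s t : State V) : ℝ :=
  energyNorm (s.u.1 - t.u.1) (s.J.1 - t.J.1) + ‖(s.p.1 - t.p.1 : L20 Ω)‖
    + ‖(s.pot.1 - t.pot.1 : L20 Ω)‖ + ‖grad (s.temp.1 - t.temp.1)‖

/-- Well-posedness of the discrete problem at the source `D`: there is exactly one solution, and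
the solution depends continuously on the source. -/
def WellPosed (P : Params d) (D : Source Ω) (V : Spaces Ω) : Prop :=
  (∃! s : State V, IsSolution P D V s) ∧
  (∀ s : State V, IsSolution P D V s → ∀ ε > 0, ∃ δ > 0, ∀ D' : Source Ω,
    dualNormX (D'.f - D.f) < δ → ‖D'.g - D.g‖ < δ → dualNormZ (D'.heat - D.heat) < δ →
      ∀ s' : State V, IsSolution P D' V s' → s'.dist s < ε)

end discrete

end IMHD

end

/-! ### Sobolev embeddings of `H₀¹(Ω)`, the constants `λ₂` and `C_Ω`, dual norms -/

noncomputable section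

namespace IMHD
open Filter Topology NNReal

variable {d : ℕ} {Ω : Set (Pt d)}

/-! Freeze the convecting velocity at some `w₀`. The problem becomes linear, of Oseen type, and
because the convection forms are skew-symmetric, its a priori bounds do not depend on `w₀`. Testing
the heat equation with the temperature gives `‖∇θ‖ ≤ λ_ψ`. Testing the momentum equation with the
pair `(u, J)` removes convection and multipliers, and coercivity gives `‖(u, J)‖₁ ≤ (‖L‖_* + λ_q
λ_ψ) / C_min`. Coercivity holds in the full `div` norm because `∇·Y_h ⊆ S_h` turns the weak
constraint into `∇·J = 0`, and the two coupling terms with `B` cancel on the diagonal. The inf-sup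
conditions then bound the multipliers by the residual of the momentum equation. So the homogeneous
linear problem has only the zero solution, and in finite dimension the linear problem is solvable
for all data.

A solution of the nonlinear problem is a fixed point of the map sending `w₀` to the velocity-current
part `w` of the linearized solution. The difference of two linearized solutions solves a linearized
problem with the extra data `-c(w₁ - w₀, w, ·)` and `-h(w₁ - w₀, z, ·)`, so the same a priori bounds
show that the map is Lipschitz with constant `CoupledForms.factor`. This constant is the sum of the
first three terms of `σ`, hence less than one, and Banach's theorem gives existence. Applied to two
nonlinear solutions with possibly different data, the same estimate (`IsOseen.normW_sub_le`) absorbs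
the velocity difference on the left, which gives uniqueness and Lipschitz dependence on the data.

The analytic input is the embedding `H₀¹(Ω) ⊆ L⁶(Ω)`. It makes the sets defining `λ₂` and `C_Ω`
nonempty, so that these infima are attained, and with Hölder's inequality it makes every integral in
the forms converge. Everything after that is the abstract argument for `CoupledForms`. -/

theorem IsTestFunction.add {F : Type} [NormedAddCommGroup F] [NormedSpace ℝ F] {f g : Pt d → F}
    (hf : IsTestFunction Ω f) (hg : IsTestFunction Ω g) : IsTestFunction Ω (f + g) :=
  ⟨hf.1.add hg.1, hf.2.1.add hg.2.1,
    (tsupport_add f g).trans (Set.union_subset hf.2.2 hg.2.2)⟩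

theorem IsTestFunction.const_smul {F : Type} [NormedAddCommGroup F] [NormedSpace ℝ F] {f : Pt d → F}
    (c : ℝ) (hf : IsTestFunction Ω f) : IsTestFunction Ω (c • f) :=
  ⟨hf.1.const_smul c, hf.2.1.smul_left (f := fun _ => c),
    (tsupport_smul_subset_right (fun _ => c) f).trans hf.2.2⟩

theorem gradient_add_of_contDiff {f g : Pt d → ℝ} (hf : ContDiff ℝ ∞ f) (hg : ContDiff ℝ ∞ g) :
    gradient (f + g) = gradient f + gradient g := by
  ext1 x
  simp only [gradient, Pi.add_apply]
  rw [fderiv_add (hf.differentiable (by simp) x) (hg.differentiable (by simp) x), map_add]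

theorem gradient_smul_of_contDiff {f : Pt d → ℝ} (c : ℝ) (hf : ContDiff ℝ ∞ f) :
    gradient (c • f) = c • gradient f := by
  ext1 x
  simp only [gradient, Pi.smul_apply]
  rw [fderiv_const_smul (hf.differentiable (by simp) x), map_smul]

/-- Test pairs already form a subspace, so every element of the span whose closure defines `H10`
comes from a single test function. Density arguments can therefore start from one classical
function. -/
theorem span_testGradPairs_subset :
    (Submodule.span ℝ (testGradPairs Ω) : Set (L2 Ω ℝ × L2 Ω (Pt d))) ⊆ testGradPairs Ω := by
  intro z hz
  induction hz using Submodule.span_induction with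
  | mem z h => exact h
  | zero =>
    refine ⟨0, ⟨contDiff_const, HasCompactSupport.zero, by simp [tsupport]⟩,
      Lp.coeFn_zero _ _ _, ?_⟩
    have : gradient (0 : Pt d → ℝ) = 0 := by
      ext1 x; simp [gradient]
    rw [this]
    exact Lp.coeFn_zero _ _ _
  | add a b _ _ ha hb =>
    obtain ⟨f, hf, h1, h2⟩ := ha
    obtain ⟨g, hg, h3, h4⟩ := hb
    refine ⟨f + g, hf.add hg, (Lp.coeFn_add _ _).trans (h1.add h3), ?_⟩
    rw [gradient_add_of_contDiff hf.1 hg.1]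
    exact (Lp.coeFn_add _ _).trans (h2.add h4)
  | smul c a _ ha =>
    obtain ⟨f, hf, h1, h2⟩ := ha
    refine ⟨c • f, hf.const_smul c, (Lp.coeFn_smul _ _).trans (h1.const_smul c), ?_⟩
    rw [gradient_smul_of_contDiff c hf.1]
    exact (Lp.coeFn_smul _ _).trans (h2.const_smul c)

/-- The Sobolev inequality for test functions. -/
theorem exists_eLpNorm_six_test_le (hd : d = 2 ∨ d = 3) (hΩb : Bornology.IsBounded Ω) :
    ∃ C : ℝ≥0, ∀ φ : Pt d → ℝ, IsTestFunction Ω φ →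
      eLpNorm φ 6 (volume.restrict Ω) ≤ C * eLpNorm (gradient φ) 2 (volume.restrict Ω) := by
  -- Gagliardo–Nirenberg–Sobolev with an exponent `p < d`, followed by Hölder on the bounded set `Ω`
  -- to raise the gradient exponent from `p` to `2`. Test functions vanish off `Ω`, so the
  -- inequality on the whole space applies and the boundary plays no role.
  have key : ∀ p : ℝ≥0, 1 ≤ p → p ≤ 2 → (p : ℝ) < d → (p : ℝ)⁻¹ - (d : ℝ)⁻¹ ≤ (6 : ℝ)⁻¹ →
      ∃ C : ℝ≥0, ∀ φ : Pt d → ℝ, IsTestFunction Ω φ →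
      eLpNorm φ 6 (volume.restrict Ω) ≤ C * eLpNorm (gradient φ) 2 (volume.restrict Ω) := by
    intro p hp1 hp2 hpd hpq
    have hvol : (volume.restrict Ω : Measure (Pt d)) Set.univ
        ^ (1 / (p : ℝ≥0∞).toReal - 1 / (2 : ℝ≥0∞).toReal) ≠ ⊤ := by
      refine ENNReal.rpow_ne_top_of_nonneg ?_ ?_
      · rw [sub_nonneg]
        apply one_div_le_one_div_of_le
        · simpa using lt_of_lt_of_le one_pos hp1
        · exact NNReal.coe_le_coe.2 hp2
      · rw [Measure.restrict_apply_univ]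
        exact hΩb.measure_lt_top.ne
    lift (volume.restrict Ω : Measure (Pt d)) Set.univ
        ^ (1 / (p : ℝ≥0∞).toReal - 1 / (2 : ℝ≥0∞).toReal) to ℝ≥0 using hvol with V hV
    refine ⟨eLpNormLESNormFDerivOfLeConst ℝ (volume : Measure (Pt d)) Ω p 6 * V,
      fun φ hφ => ?_⟩
    have hsupp : φ.support ⊆ Ω := (subset_tsupport φ).trans hφ.2.2
    have hfd : ∀ x, ‖gradient φ x‖ = ‖fderiv ℝ φ x‖ := fun x => by simp [gradient]
    have hsg : (gradient φ).support ⊆ Ω := by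
      intro x hx
      apply hφ.2.2
      apply support_fderiv_subset ℝ (f := φ)
      rw [Function.mem_support, ← norm_ne_zero_iff] at hx ⊢
      rwa [← hfd]
    have hsob := eLpNorm_le_eLpNorm_fderiv_of_le (volume : Measure (Pt d)) (u := φ) (s := Ω)
      (p := p) (q := 6) (hφ.1.of_le (by simp)) hsupp hp1 (by simpa using! hpd)
      (by simpa using hpq) hΩb
    rw [eLpNorm_restrict_eq_of_support_subset hsupp]
    refine hsob.trans ?_
    rw [← eLpNorm_congr_norm_ae (f := gradient φ) (Eventually.of_forall hfd),
      ← eLpNorm_restrict_eq_of_support_subset hsg, ENNReal.coe_mul, mul_assoc]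
    gcongr
    rw [mul_comm, hV]
    refine eLpNorm_le_eLpNorm_mul_rpow_measure_univ (by exact_mod_cast hp2) ?_
    have : Continuous (gradient φ) :=
      (LinearIsometryEquiv.continuous _).comp (hφ.1.continuous_fderiv (by simp))
    exact this.aestronglyMeasurable
  -- The exponents with `1/p - 1/d = 1/6` exactly. For `d = 2` the choice `p = 2` is excluded by `p
  -- < d`.
  rcases hd with rfl | rfl
  · exact key (3 / 2) (by rw [← NNReal.coe_le_coe]; norm_num) (by rw [← NNReal.coe_le_coe]; norm_num)
      (by norm_num) (by norm_num)
  · exact key 2 (by rw [← NNReal.coe_le_coe]; norm_num) le_rfl (by norm_num) (by norm_num)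

/-- The Sobolev embedding `H₀¹(Ω) ⊆ L⁶(Ω)`. -/
theorem exists_eLpNorm_six_le (hd : d = 2 ∨ d = 3) (hΩb : Bornology.IsBounded Ω) :
    ∃ C : ℝ≥0, ∀ r : SpZ Ω, eLpNorm (fn r) 6 (volume.restrict Ω) ≤ C * ‖grad r‖ₑ := by
  obtain ⟨C, hC⟩ := exists_eLpNorm_six_test_le hd hΩb
  refine ⟨C, fun r => ?_⟩
  have hr : (r : L2 Ω ℝ × L2 Ω (Pt d)) ∈
      closure (Submodule.span ℝ (testGradPairs Ω) : Set (L2 Ω ℝ × L2 Ω (Pt d))) := r.2.2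
  obtain ⟨s, hs, hlim⟩ := mem_closure_iff_seq_limit.1 hr
  have hsb : ∀ n, eLpNorm (s n).1 6 (volume.restrict Ω) ≤ C * ‖(s n).2‖ₑ := fun n => by
    obtain ⟨φ, hφ, h1, h2⟩ := span_testGradPairs_subset (hs n)
    rw [eLpNorm_congr_ae h1, Lp.enorm_def, eLpNorm_congr_ae h2]
    exact hC φ hφ
  have h1 : Tendsto (fun n => (s n).1) atTop (𝓝 (fn r)) := (continuous_fst.tendsto _).comp hlim
  have h2 : Tendsto (fun n => ‖(s n).2‖ₑ) atTop (𝓝 ‖grad r‖ₑ) :=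
    (continuous_enorm.tendsto _).comp ((continuous_snd.tendsto _).comp hlim)
  have h3 : Tendsto (fun n => (C : ℝ≥0∞) * ‖(s n).2‖ₑ) atTop (𝓝 (C * ‖grad r‖ₑ)) :=
    ENNReal.Tendsto.const_mul h2 (Or.inr ENNReal.coe_ne_top)
  -- The `L⁶` norm is lower semicontinuous under convergence in measure, which `L²` convergence
  -- implies. Any `b` above the limit of the bounds eventually dominates them.
  refine le_of_forall_gt_imp_ge_of_dense fun b hb => ?_
  refine eLpNorm_le_of_tendstoInMeasure ?_ (tendstoInMeasure_of_tendsto_Lp h1)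
    (fun n => Lp.aestronglyMeasurable _)
  filter_upwards [h3.eventually_lt_const hb] with n hn
  exact (hsb n).trans hn.le

/-- Hölder's inequality on a set of finite measure lowers the exponent from `6` to `p`. -/
theorem exists_eLpNorm_le (hd : d = 2 ∨ d = 3) (hΩb : Bornology.IsBounded Ω) {p : ℝ≥0∞}
    (hp0 : p ≠ 0) (hp : p ≤ 6) :
    ∃ C : ℝ≥0, ∀ r : SpZ Ω, eLpNorm (fn r) p (volume.restrict Ω) ≤ C * ‖grad r‖ₑ := by
  obtain ⟨C, hC⟩ := exists_eLpNorm_six_le hd hΩb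
  have hvol : (volume.restrict Ω : Measure (Pt d)) Set.univ
      ^ (1 / p.toReal - 1 / (6 : ℝ≥0∞).toReal) ≠ ⊤ := by
    refine ENNReal.rpow_ne_top_of_nonneg ?_ ?_
    · rw [sub_nonneg]
      apply one_div_le_one_div_of_le
      · exact ENNReal.toReal_pos hp0 (ne_top_of_le_ne_top (by simp) hp)
      · exact ENNReal.toReal_mono (by simp) hp
    · rw [Measure.restrict_apply_univ]
      exact hΩb.measure_lt_top.ne
  lift (volume.restrict Ω : Measure (Pt d)) Set.univ
      ^ (1 / p.toReal - 1 / (6 : ℝ≥0∞).toReal) to ℝ≥0 using hvol with V hV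
  refine ⟨V * C, fun r => ?_⟩
  refine (eLpNorm_le_eLpNorm_mul_rpow_measure_univ hp (Lp.aestronglyMeasurable _)).trans ?_
  rw [← hV, mul_comm, ENNReal.coe_mul, mul_assoc]
  gcongr
  exact hC r

theorem memLp_fn (hd : d = 2 ∨ d = 3) (hΩb : Bornology.IsBounded Ω) {p : ℝ≥0∞}
    (hp0 : p ≠ 0) (hp : p ≤ 6) (r : SpZ Ω) : MemLp (fn r) p (volume.restrict Ω) := by
  obtain ⟨C, hC⟩ := exists_eLpNorm_le hd hΩb hp0 hp
  exact ⟨Lp.aestronglyMeasurable _, (hC r).trans_lt (ENNReal.mul_lt_top (by simp) (by simp))⟩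

theorem aestronglyMeasurable_vec (v : SpX Ω) :
    AEStronglyMeasurable (vec v) (volume.restrict Ω) := by
  refine (PiLp.continuous_toLp 2 _).comp_aestronglyMeasurable ?_
  exact (aemeasurable_pi_lambda _ fun i =>
    (Lp.aestronglyMeasurable (fn (v i))).aemeasurable).aestronglyMeasurable

theorem norm_grad_le_gradNorm (v : SpX Ω) (i : Fin d) : ‖grad (v i)‖ ≤ gradNorm v := by
  refine Real.le_sqrt_of_sq_le ?_
  exact Finset.single_le_sum (f := fun i => ‖grad (v i)‖ ^ 2) (fun _ _ => sq_nonneg _)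
    (Finset.mem_univ i)

theorem gradNorm_nonneg (v : SpX Ω) : 0 ≤ gradNorm v := Real.sqrt_nonneg _

/-- The triangle inequality over the components loses a factor `d`. This is harmless, since only the
existence of some constant matters here. -/
theorem exists_eLpNorm_vec_le (hd : d = 2 ∨ d = 3) (hΩb : Bornology.IsBounded Ω) {p : ℝ≥0∞}
    (hp1 : 1 ≤ p) (hp : p ≤ 6) :
    ∃ C : ℝ≥0, ∀ v : SpX Ω,
      eLpNorm (vec v) p (volume.restrict Ω) ≤ C * ENNReal.ofReal (gradNorm v) := by
  obtain ⟨C, hC⟩ := exists_eLpNorm_le (Ω := Ω) hd hΩb (zero_lt_one.trans_le hp1).ne' hp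
  refine ⟨d * C, fun v => ?_⟩
  have h1 : eLpNorm (vec v) p (volume.restrict Ω)
      ≤ eLpNorm (∑ i, fun x => ‖fn (v i) x‖) p (volume.restrict Ω) := by
    refine eLpNorm_mono_real fun x => ?_
    rw [Finset.sum_apply]
    have : vec v x = ∑ i, EuclideanSpace.single i (fn (v i) x) := by
      ext j
      simp [vec, Finset.sum_apply, Pi.single_apply]
    rw [this]
    refine (norm_sum_le _ _).trans (Finset.sum_le_sum fun i _ => ?_)
    simp
  refine h1.trans ((eLpNorm_sum_le (fun i _ => (Lp.aestronglyMeasurable _).norm) hp1).trans ?_)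
  have h2 : ∀ i ∈ Finset.univ, eLpNorm (fun x => ‖fn (v i) x‖) p (volume.restrict Ω)
      ≤ C * ENNReal.ofReal (gradNorm v) := fun i _ => by
    rw [eLpNorm_norm]
    refine (hC (v i)).trans ?_
    gcongr
    rw [← ofReal_norm]
    exact ENNReal.ofReal_le_ofReal (norm_grad_le_gradNorm v i)
  refine (Finset.sum_le_sum h2).trans (le_of_eq ?_)
  simp [mul_assoc]

theorem memLp_vec (hd : d = 2 ∨ d = 3) (hΩb : Bornology.IsBounded Ω) {p : ℝ≥0∞}
    (hp1 : 1 ≤ p) (hp : p ≤ 6) (v : SpX Ω) : MemLp (vec v) p (volume.restrict Ω) := by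
  obtain ⟨C, hC⟩ := exists_eLpNorm_vec_le (Ω := Ω) hd hΩb hp1 hp
  exact ⟨aestronglyMeasurable_vec v,
    (hC v).trans_lt (ENNReal.mul_lt_top (by simp) (by simp))⟩

/-- A closed nonempty set of nonnegative reals contains its infimum. -/
theorem sInf_mem_of_nonneg {s : Set ℝ} (hs : IsClosed s) (hne : s.Nonempty)
    (h0 : ∀ c ∈ s, 0 ≤ c) : sInf s ∈ s :=
  hs.csInf_mem hne ⟨0, h0⟩

theorem isClosed_le_ofReal_mul (a : ℝ≥0∞) (b : ℝ) :
    IsClosed {c : ℝ | a ≤ ENNReal.ofReal (c * b)} :=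
  isClosed_le continuous_const (ENNReal.continuous_ofReal.comp (continuous_id.mul continuous_const))

/-- The infimum is attained: each inequality is a closed condition on `c`, and the embedding into
`L⁴` shows that some `c` satisfies them all. Without the latter, `sInf` would take its default value
`0` and carry no information. -/
theorem lam2_spec (hd : d = 2 ∨ d = 3) (hΩb : Bornology.IsBounded Ω) :
    0 ≤ lam2 Ω ∧
    (∀ v : SpX Ω, eLpNorm (vec v) 4 (volume.restrict Ω) ^ 2
      ≤ ENNReal.ofReal (lam2 Ω * gradNorm v ^ 2)) ∧
    (∀ r : SpZ Ω, eLpNorm (fn r) 4 (volume.restrict Ω) ^ 2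
      ≤ ENNReal.ofReal (lam2 Ω * ‖grad r‖ ^ 2)) := by
  refine sInf_mem_of_nonneg (s := {c : ℝ | 0 ≤ c ∧
    (∀ v : SpX Ω, eLpNorm (vec v) 4 (volume.restrict Ω) ^ 2 ≤ ENNReal.ofReal (c * gradNorm v ^ 2)) ∧
    (∀ r : SpZ Ω, eLpNorm (fn r) 4 (volume.restrict Ω) ^ 2 ≤ ENNReal.ofReal (c * ‖grad r‖ ^ 2))})
    ?_ ?_ fun c hc => hc.1
  · simp only [Set.ofPred_and, Set.ofPred_forall]
    exact isClosed_Ici.inter ((isClosed_iInter fun v => isClosed_le_ofReal_mul _ _).inter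
      (isClosed_iInter fun r => isClosed_le_ofReal_mul _ _))
  · have h46 : (4 : ℝ≥0∞) ≤ 6 := by norm_num
    obtain ⟨C₁, h₁⟩ := exists_eLpNorm_vec_le (Ω := Ω) hd hΩb (p := 4) (by norm_num) h46
    obtain ⟨C₂, h₂⟩ := exists_eLpNorm_le (Ω := Ω) hd hΩb (p := 4) (by norm_num) h46
    have hb : ∀ (a : ℝ≥0∞) (C : ℝ≥0) (t : ℝ), 0 ≤ t → C ≤ max C₁ C₂ → a ≤ C * ENNReal.ofReal t →
        a ^ 2 ≤ ENNReal.ofReal (((max C₁ C₂ : ℝ≥0) : ℝ) ^ 2 * t ^ 2) := by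
      intro a C t ht hC ha
      rw [← mul_pow, ENNReal.ofReal_pow (by positivity), ENNReal.ofReal_mul (by positivity),
        ENNReal.ofReal_coe_nnreal]
      gcongr
      exact ha.trans (by gcongr)
    refine ⟨((max C₁ C₂ : ℝ≥0) : ℝ) ^ 2, by positivity, fun v => ?_, fun r => ?_⟩
    · exact hb _ C₁ _ (gradNorm_nonneg v) (le_max_left _ _) (h₁ v)
    · exact hb _ C₂ _ (norm_nonneg _) (le_max_right _ _) (by simpa using h₂ r)

/-- Attained for the same reason as `λ₂`, with `L²` in place of `L⁴`. -/
theorem cOmega_spec (hd : d = 2 ∨ d = 3) (hΩb : Bornology.IsBounded Ω) :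
    0 ≤ cOmega Ω ∧
    (∀ v : SpX Ω, eLpNorm (vec v) 2 (volume.restrict Ω)
      ≤ ENNReal.ofReal (cOmega Ω * gradNorm v)) ∧
    (∀ r : SpZ Ω, ‖fn r‖ ≤ cOmega Ω * ‖grad r‖) := by
  refine sInf_mem_of_nonneg (s := {c : ℝ | 0 ≤ c ∧
    (∀ v : SpX Ω, eLpNorm (vec v) 2 (volume.restrict Ω) ≤ ENNReal.ofReal (c * gradNorm v)) ∧
    (∀ r : SpZ Ω, ‖fn r‖ ≤ c * ‖grad r‖)}) ?_ ?_ fun c hc => hc.1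
  · simp only [Set.ofPred_and, Set.ofPred_forall]
    exact isClosed_Ici.inter ((isClosed_iInter fun v => isClosed_le_ofReal_mul _ _).inter
      (isClosed_iInter fun r => isClosed_le continuous_const (continuous_id.mul continuous_const)))
  · have h26 : (2 : ℝ≥0∞) ≤ 6 := by norm_num
    obtain ⟨C₁, h₁⟩ := exists_eLpNorm_vec_le (Ω := Ω) hd hΩb (p := 2) (by norm_num) h26
    obtain ⟨C₂, h₂⟩ := exists_eLpNorm_le (Ω := Ω) hd hΩb (p := 2) (by norm_num) h26
    refine ⟨((max C₁ C₂ : ℝ≥0) : ℝ), by positivity, fun v => ?_, fun r => ?_⟩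
    · rw [ENNReal.ofReal_mul (by positivity), ENNReal.ofReal_coe_nnreal]
      exact (h₁ v).trans (by gcongr; exact le_max_left _ _)
    · have h := h₂ r
      rw [← Lp.enorm_def, ← ofReal_norm, ← ofReal_norm,
        ← ENNReal.ofReal_coe_nnreal, ← ENNReal.ofReal_mul (by positivity),
        ENNReal.ofReal_le_ofReal_iff (by positivity)] at h
      exact h.trans (by gcongr; exact le_max_right _ _)

/-- The ambient norm is the maximum of `‖r‖₀` and `‖∇r‖₀`. The factor `C_Ω + 1` covers both, so
functionals continuous for this norm are bounded by the gradient norm. -/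
theorem norm_le_norm_grad (hd : d = 2 ∨ d = 3) (hΩb : Bornology.IsBounded Ω) (r : SpZ Ω) :
    ‖r‖ ≤ (cOmega Ω + 1) * ‖grad r‖ := by
  obtain ⟨h0, -, h⟩ := cOmega_spec (Ω := Ω) hd hΩb
  have h1 := h r
  have h2 := norm_nonneg (grad r)
  have h3 : 0 ≤ cOmega Ω * ‖grad r‖ := by positivity
  exact max_le (show ‖fn r‖ ≤ _ by linarith) (show ‖grad r‖ ≤ _ by linarith)

theorem norm_le_gradNorm (hd : d = 2 ∨ d = 3) (hΩb : Bornology.IsBounded Ω) (v : SpX Ω) :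
    ‖v‖ ≤ (cOmega Ω + 1) * gradNorm v := by
  have h0 := (cOmega_spec (Ω := Ω) hd hΩb).1
  have h1 := gradNorm_nonneg v
  refine (pi_norm_le_iff_of_nonneg (by positivity)).2 fun i => ?_
  exact (norm_le_norm_grad hd hΩb _).trans (by gcongr; exact norm_grad_le_gradNorm v i)

/-- A continuous functional is bounded by its dual norm with respect to any function which
dominates the norm, vanishes at zero and is invariant under sign changes. -/
theorem abs_le_iSup_div_mul {E : Type*} [NormedAddCommGroup E] [NormedSpace ℝ E] (N : E → ℝ)
    {c : ℝ} (hc : 0 ≤ c) (hN : ∀ v, ‖v‖ ≤ c * N v) (hN0 : N 0 = 0)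
    (hneg : ∀ v, N (-v) = N v) (f : E →L[ℝ] ℝ) :
    0 ≤ (⨆ v : {v : E // v ≠ 0}, f v.1 / N v.1) ∧
    ∀ v, |f v| ≤ (⨆ v : {v : E // v ≠ 0}, f v.1 / N v.1) * N v := by
  have hpos : ∀ v, v ≠ 0 → 0 < N v := fun v hv => by
    by_contra! h
    have h1 := hN v
    have h2 := norm_pos_iff.2 hv
    nlinarith
  -- A real supremum over an unbounded family would be `0`; continuity of `f` excludes this.
  have hbdd : BddAbove (Set.range fun v : {v : E // v ≠ 0} => f v.1 / N v.1) := by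
    refine ⟨‖f‖ * c, ?_⟩
    rintro _ ⟨⟨v, hv⟩, rfl⟩
    rw [div_le_iff₀ (hpos v hv), mul_assoc]
    exact ((le_abs_self _).trans (f.le_opNorm v)).trans (by gcongr; exact hN v)
  have hle : ∀ v, v ≠ 0 → f v ≤ (⨆ v : {v : E // v ≠ 0}, f v.1 / N v.1) * N v := fun v hv => by
    rw [← div_le_iff₀ (hpos v hv)]
    exact le_ciSup hbdd ⟨v, hv⟩
  have habs : ∀ v, v ≠ 0 → |f v| ≤ (⨆ v : {v : E // v ≠ 0}, f v.1 / N v.1) * N v := fun v hv => by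
    refine abs_le'.2 ⟨hle v hv, ?_⟩
    simpa [hneg] using hle (-v) (neg_ne_zero.2 hv)
  constructor
  · by_cases hE : ∃ v : E, v ≠ 0
    · obtain ⟨v, hv⟩ := hE
      exact nonneg_of_mul_nonneg_left ((abs_nonneg _).trans (habs v hv)) (hpos v hv)
    -- In the trivial space the supremum is over an empty family and has the value `0`.
    · push Not at hE
      have : IsEmpty {v : E // v ≠ 0} := ⟨fun v => v.2 (hE v.1)⟩
      rw [Real.iSup_of_isEmpty]
  · intro v
    by_cases hv : v = 0
    · subst hv
      simp [hN0]
    · exact habs v hv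

end IMHD
end

/-! ### Abstract theory of coupled saddle point problems with skew convection -/

noncomputable section

/-- The norm structure given by a definite seminorm. -/
abbrev Seminorm.normedAddCommGroupOfDefinite {W : Type*} [AddCommGroup W] [Module ℝ W]
    (N : Seminorm ℝ W) (hN : ∀ w, N w = 0 → w = 0) : NormedAddCommGroup W :=
  AddGroupNorm.toNormedAddCommGroup
    { toFun := N
      map_zero' := map_zero N
      add_le' := map_add_le_add N
      neg' := map_neg_eq_map N
      eq_zero_of_map_eq_zero' := hN }

/-- A map which contracts a definite seminorm on a finite-dimensional space has a fixed point. -/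
theorem Seminorm.exists_fixedPoint_of_contracting {W : Type*} [AddCommGroup W] [Module ℝ W]
    [FiniteDimensional ℝ W] (N : Seminorm ℝ W) (hN : ∀ w, N w = 0 → w = 0) (T : W → W)
    {k : ℝ} (hk : k < 1) (hT : ∀ x y, N (T x - T y) ≤ k * N (x - y)) : ∃ x, T x = x := by
  let _ : NormedAddCommGroup W := N.normedAddCommGroupOfDefinite hN
  let _ : NormedSpace ℝ W := { norm_smul_le := fun a b => (map_smul_eq_mul N a b).le }
  have : CompleteSpace W := FiniteDimensional.complete ℝ W
  -- A negative `k` is allowed: truncating it at `0` only weakens the Lipschitz bound.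
  have hc : ContractingWith (Real.toNNReal k) T := by
    refine ⟨by simpa using hk, LipschitzWith.of_dist_le_mul fun x y => ?_⟩
    rw [dist_eq_norm, dist_eq_norm]
    exact (hT x y).trans (mul_le_mul_of_nonneg_right (Real.le_coe_toNNReal k) (apply_nonneg N _))
  exact ⟨_, hc.fixedPoint_isFixedPt⟩

/-- Bilinear forms on a finite-dimensional space are bounded in every definite seminorm. -/
theorem Seminorm.exists_bilinear_bound {W : Type*} [AddCommGroup W] [Module ℝ W]
    [FiniteDimensional ℝ W] (N : Seminorm ℝ W) (hN : ∀ w, N w = 0 → w = 0)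
    (A : W →ₗ[ℝ] W →ₗ[ℝ] ℝ) : ∃ C, 0 ≤ C ∧ ∀ w v, |A w v| ≤ C * N w * N v := by
  let _ : NormedAddCommGroup W := N.normedAddCommGroupOfDefinite hN
  let _ : NormedSpace ℝ W := { norm_smul_le := fun a b => (map_smul_eq_mul N a b).le }
  exact ⟨‖A.toContinuousBilinearMap‖, norm_nonneg A.toContinuousBilinearMap,
    fun w v => A.toContinuousBilinearMap.le_opNorm₂ w v⟩

/-- The forms of a coupled saddle point problem: velocity-type unknowns in `W`, multipliers in `M`
and temperatures in `Z`, together with the bounds of the forms. -/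
structure CoupledForms (W M Z : Type*) [AddCommGroup W] [Module ℝ W] [AddCommGroup M] [Module ℝ M]
    [AddCommGroup Z] [Module ℝ Z] where
  A : W →ₗ[ℝ] W →ₗ[ℝ] ℝ
  c : W →ₗ[ℝ] W →ₗ[ℝ] W →ₗ[ℝ] ℝ
  B : M →ₗ[ℝ] W →ₗ[ℝ] ℝ
  Q : Z →ₗ[ℝ] W →ₗ[ℝ] ℝ
  e : Z →ₗ[ℝ] Z →ₗ[ℝ] ℝ
  h : W →ₗ[ℝ] Z →ₗ[ℝ] Z →ₗ[ℝ] ℝ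
  normW : Seminorm ℝ W
  normM : M → ℝ
  normZ : Z → ℝ
  coer : ℝ
  bdA : ℝ
  bdB : ℝ
  bdc : ℝ
  bdQ : ℝ
  coer_pos : 0 < coer
  bdc_nonneg : 0 ≤ bdc
  bdQ_nonneg : 0 ≤ bdQ
  normW_def : ∀ w, normW w = 0 → w = 0
  normM_def : ∀ m, normM m ≤ 0 → m = 0
  normZ_nonneg : ∀ z, 0 ≤ normZ z
  normZ_def : ∀ z, normZ z = 0 → z = 0
  coercive : ∀ w, (∀ m, B m w = 0) → coer * normW w ^ 2 ≤ A w w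
  A_le : ∀ w v, |A w v| ≤ bdA * normW w * normW v
  c_self : ∀ w u, c w u u = 0
  c_le : ∀ w u v, |c w u v| ≤ bdc * normW w * normW u * normW v
  Q_le : ∀ z v, |Q z v| ≤ bdQ * normZ z * normW v
  e_self : ∀ z, e z z = normZ z ^ 2
  h_self : ∀ w z, h w z z = 0
  h_le : ∀ w z r, |h w z r| ≤ bdc * normW w * normZ z * normZ r
  -- The inf-sup condition in the form in which it is used: a bound for the functional `B m` bounds
  -- `m`.
  infSup : ∀ m k, 0 ≤ k → (∀ v, |B m v| ≤ k * normW v) → normM m ≤ bdB * k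

namespace CoupledForms

variable {W M Z : Type*} [AddCommGroup W] [Module ℝ W] [AddCommGroup M] [Module ℝ M]
    [AddCommGroup Z] [Module ℝ Z] (F : CoupledForms W M Z)

/-- `(w, m, z)` solves the problem linearized at `w₀`, with right-hand sides `L` and `φ`. -/
structure IsOseen (w₀ : W) (L : W →ₗ[ℝ] ℝ) (φ : Z →ₗ[ℝ] ℝ) (w : W) (m : M) (z : Z) : Prop where
  momentum : ∀ v, F.A w v + F.c w₀ w v + F.B m v + F.Q z v = L v
  constraint : ∀ m', F.B m' w = 0
  heat : ∀ r, F.e z r + F.h w₀ z r = φ r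

variable {F} {w₀ w₁ w w' : W} {L L' : W →ₗ[ℝ] ℝ} {φ φ' : Z →ₗ[ℝ] ℝ} {m m' : M} {z z' : Z}
  {l t : ℝ}

/-- Translates between the bundled linear maps and the plain real-valued forms of the discrete
problem. -/
theorem isOseen_iff {a : W → W → ℝ} {c : W → W → W → ℝ} {b : M → W → ℝ} {q : Z → W → ℝ}
    {e : Z → Z → ℝ} {h : W → Z → Z → ℝ} (hA : ∀ x y, F.A x y = a x y)
    (hc : ∀ x y z, F.c x y z = c x y z) (hB : ∀ m x, F.B m x = b m x)
    (hQ : ∀ z x, F.Q z x = q z x) (he : ∀ z r, F.e z r = e z r)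
    (hh : ∀ x z r, F.h x z r = h x z r) :
    F.IsOseen w₀ L φ w m z ↔ (∀ v, a w v + c w₀ w v + b m v + q z v = L v) ∧
      (∀ m', b m' w = 0) ∧ ∀ r, e z r + h w₀ z r = φ r := by
  simp only [← hA, ← hc, ← hB, ← hQ, ← he, ← hh]
  exact ⟨fun H => ⟨H.1, H.2, H.3⟩, fun H => ⟨H.1, H.2.1, H.2.2⟩⟩

/-- Test the heat equation with `z` itself; the convection term vanishes and `normZ z ^ 2 ≤ t *
normZ z` remains. -/
theorem IsOseen.normZ_le (H : F.IsOseen w₀ L φ w m z) (ht : 0 ≤ t)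
    (hφ : ∀ r, |φ r| ≤ t * F.normZ r) : F.normZ z ≤ t := by
  have h1 := H.heat z
  rw [F.h_self, F.e_self, add_zero] at h1
  have h2 := (le_abs_self _).trans (hφ z)
  have h3 := F.normZ_nonneg z
  by_contra! hlt
  nlinarith

/-- Test the momentum equation with `w`: convection vanishes by skew-symmetry, the multiplier term
by the constraint. Coercivity and the temperature bound give the rest, so `w₀` leaves no trace in
the estimate. -/
theorem IsOseen.normW_le (H : F.IsOseen w₀ L φ w m z) (hl : 0 ≤ l) (ht : 0 ≤ t)
    (hL : ∀ v, |L v| ≤ l * F.normW v) (hφ : ∀ r, |φ r| ≤ t * F.normZ r) :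
    F.normW w ≤ (l + F.bdQ * t) / F.coer := by
  have hz := H.normZ_le ht hφ
  have h1 := H.momentum w
  rw [F.c_self, H.constraint] at h1
  have h2 := F.coercive w H.constraint
  have h3 := (le_abs_self _).trans (hL w)
  have h4 := (neg_le_abs _).trans (F.Q_le z w)
  have h5 : 0 ≤ F.normW w := apply_nonneg _ _
  have h6 : F.bdQ * F.normZ z * F.normW w ≤ F.bdQ * t * F.normW w := by
    have := F.bdQ_nonneg; gcongr
  have hb := mul_nonneg F.bdQ_nonneg ht
  have hc := F.coer_pos
  rw [le_div_iff₀ hc]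
  by_contra! hlt
  have h7 : 0 < F.normW w := by
    rcases h5.lt_or_eq with h | h
    · exact h
    · rw [← h] at hlt; linarith
  nlinarith

/-- The momentum equation expresses `B m` as a residual in the other unknowns, to which the inf-sup
bound applies. -/
theorem IsOseen.normM_le (H : F.IsOseen w₀ L φ w m z) (hl : 0 ≤ l)
    (hA : 0 ≤ F.bdA) (hL : ∀ v, |L v| ≤ l * F.normW v) :
    F.normM m ≤ F.bdB * (l + F.bdA * F.normW w + F.bdc * F.normW w₀ * F.normW w
      + F.bdQ * F.normZ z) := by
  have hw : 0 ≤ F.normW w := apply_nonneg _ _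
  have hw₀ : 0 ≤ F.normW w₀ := apply_nonneg _ _
  have hz := F.normZ_nonneg z
  have hc := F.bdc_nonneg
  have hQ := F.bdQ_nonneg
  refine F.infSup m _ (by positivity) fun v => ?_
  have h0 : F.B m v = L v - F.A w v - F.c w₀ w v - F.Q z v := by
    rw [← H.momentum v]; ring
  rw [h0]
  have h1 := abs_le.1 (hL v)
  have h2 := abs_le.1 (F.A_le w v)
  have h3 := abs_le.1 (F.c_le w₀ w v)
  have h4 := abs_le.1 (F.Q_le z v)
  rw [abs_le]
  constructor <;> nlinarith

/-- The difference of two linearized solutions solves a linearized problem. -/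
theorem IsOseen.sub (H' : F.IsOseen w₁ L' φ' w' m' z') (H : F.IsOseen w₀ L φ w m z) :
    F.IsOseen w₁ (L' - L - F.c (w₁ - w₀) w) (φ' - φ - F.h (w₁ - w₀) z)
      (w' - w) (m' - m) (z' - z) := by
  refine ⟨fun v => ?_, fun q => ?_, fun r => ?_⟩
  -- The splitting `c(w₁, w') - c(w₀, w) = c(w₁, w' - w) + c(w₁ - w₀, w)` keeps `w₁` as
  -- linearization point and moves the last term to the data.
  · simp only [map_sub, LinearMap.sub_apply, ← H'.momentum v, ← H.momentum v]
    ring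
  · rw [map_sub, H'.constraint, H.constraint, sub_zero]
  · simp only [map_sub, LinearMap.sub_apply, ← H'.heat r, ← H.heat r]
    ring

theorem abs_sub_c_le (hL : ∀ v, |(L' - L) v| ≤ l * F.normW v) (u w v : W) :
    |(L' - L - F.c u w) v| ≤ (l + F.bdc * F.normW u * F.normW w) * F.normW v := by
  have h1 := hL v
  have h2 := F.c_le u w v
  rw [LinearMap.sub_apply, add_mul]
  exact (abs_sub _ _).trans (add_le_add h1 h2)

theorem abs_sub_h_le (hφ : ∀ r, |(φ' - φ) r| ≤ t * F.normZ r) (u : W) (z r : Z) :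
    |(φ' - φ - F.h u z) r| ≤ (t + F.bdc * F.normW u * F.normZ z) * F.normZ r := by
  have h1 := hφ r
  have h2 := F.h_le u z r
  rw [LinearMap.sub_apply, add_mul]
  exact (abs_sub _ _).trans (add_le_add h1 h2)

/-- With zero data the a priori bounds force temperature and velocity to vanish, and then the
multiplier. -/
theorem IsOseen.eq_zero (H : F.IsOseen w₀ 0 0 w m z) (hA : 0 ≤ F.bdA) : w = 0 ∧ m = 0 ∧ z = 0 := by
  have hz0 : F.normZ z = 0 :=
    le_antisymm (H.normZ_le le_rfl (by simp)) (F.normZ_nonneg z)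
  have hw0 : F.normW w = 0 :=
    le_antisymm (by simpa using H.normW_le le_rfl le_rfl (by simp) (by simp)) (apply_nonneg _ _)
  refine ⟨F.normW_def _ hw0, F.normM_def _ ?_, F.normZ_def _ hz0⟩
  simpa [hz0, hw0] using H.normM_le le_rfl hA (by simp)

variable (F)

/-- The operator of the problem linearized at `w₀`. -/
def oseenMap (w₀ : W) : (W × M × Z) →ₗ[ℝ] Module.Dual ℝ (W × M × Z) :=
  LinearMap.mk₂ ℝ
    (fun x y => F.A x.1 y.1 + F.c w₀ x.1 y.1 + F.B x.2.1 y.1 + F.Q x.2.2 y.1 + F.B y.2.1 x.1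
      + (F.e x.2.2 y.2.2 + F.h w₀ x.2.2 y.2.2))
    (by intros; simp; ring) (by intros; simp; ring) (by intros; simp; ring) (by intros; simp; ring)

/-- `oseenMap` adds the three equations; test triples with one nonzero entry separate them again. -/
theorem isOseen_of_oseenMap_eq
    (H : F.oseenMap w₀ (w, m, z) =
      L ∘ₗ LinearMap.fst ℝ W (M × Z) + φ ∘ₗ LinearMap.snd ℝ M Z ∘ₗ LinearMap.snd ℝ W (M × Z)) :
    F.IsOseen w₀ L φ w m z := by
  refine ⟨fun v => ?_, fun q => ?_, fun r => ?_⟩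
  · simpa [oseenMap] using LinearMap.congr_fun H (v, 0, 0)
  · simpa [oseenMap] using LinearMap.congr_fun H (0, q, 0)
  · simpa [oseenMap] using LinearMap.congr_fun H (0, 0, r)

/-- A finite-dimensional space and its dual have equal dimension, so the injectivity supplied by
`IsOseen.eq_zero` yields surjectivity. -/
theorem exists_isOseen [FiniteDimensional ℝ W] [FiniteDimensional ℝ M] [FiniteDimensional ℝ Z]
    (hA : 0 ≤ F.bdA) (w₀ : W) (L : W →ₗ[ℝ] ℝ) (φ : Z →ₗ[ℝ] ℝ) :
    ∃ w m z, F.IsOseen w₀ L φ w m z := by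
  have hinj : Function.Injective (F.oseenMap w₀) := by
    rw [injective_iff_map_eq_zero]
    rintro ⟨w, m, z⟩ h
    obtain ⟨rfl, rfl, rfl⟩ :=
      (F.isOseen_of_oseenMap_eq (L := 0) (φ := 0) (by simpa using h)).eq_zero hA
    rfl
  have hsurj := (LinearMap.injective_iff_surjective_of_finrank_eq_finrank
    (Subspace.dual_finrank_eq (K := ℝ) (V := W × M × Z)).symm).1 hinj
  obtain ⟨⟨w, m, z⟩, h⟩ := hsurj (L ∘ₗ LinearMap.fst ℝ W (M × Z) +
    φ ∘ₗ LinearMap.snd ℝ M Z ∘ₗ LinearMap.snd ℝ W (M × Z))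
  exact ⟨w, m, z, F.isOseen_of_oseenMap_eq h⟩

/-- The contraction factor of the map `w₀ ↦ w` for right-hand sides of norms `l` and `t`. -/
def factor (l t : ℝ) : ℝ := (F.bdc * ((l + F.bdQ * t) / F.coer) + F.bdQ * (F.bdc * t)) / F.coer

variable {F}

/-- Stability of linearized solutions with respect to the data and the linearization point. -/
theorem IsOseen.normW_sub_le (H' : F.IsOseen w₁ L' φ' w' m' z') (H : F.IsOseen w₀ L φ w m z)
    (hl : 0 ≤ l) (ht : 0 ≤ t) (hL : ∀ v, |L v| ≤ l * F.normW v)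
    (hφ : ∀ r, |φ r| ≤ t * F.normZ r) {a b : ℝ} (ha : 0 ≤ a) (hb : 0 ≤ b)
    (hL' : ∀ v, |(L' - L) v| ≤ a * F.normW v) (hφ' : ∀ r, |(φ' - φ) r| ≤ b * F.normZ r) :
    F.normW (w' - w) ≤ (a + F.bdQ * b) / F.coer + F.factor l t * F.normW (w₁ - w₀) := by
  have hz := H.normZ_le ht hφ
  have hw := H.normW_le hl ht hL hφ
  have hw0 : 0 ≤ F.normW w := apply_nonneg _ _
  have hd : 0 ≤ F.normW (w₁ - w₀) := apply_nonneg _ _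
  have hz0 := F.normZ_nonneg z
  have hc := F.bdc_nonneg
  have hQ := F.bdQ_nonneg
  have hC := F.coer_pos
  -- The a priori bound for the difference. Changing the linearization point costs `bdc * normW w`
  -- directly, and `bdc * normZ z` through the temperature, which reaches the velocity multiplied by
  -- `bdQ`; these are the two parts of `factor`. Only the unprimed data need the bounds `l` and `t`.
  have h1 := (H'.sub H).normW_le (l := a + F.bdc * F.normW (w₁ - w₀) * F.normW w)
    (t := b + F.bdc * F.normW (w₁ - w₀) * F.normZ z) (by positivity) (by positivity)
    (abs_sub_c_le hL' _ _) (abs_sub_h_le hφ' _ _)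
  refine h1.trans ?_
  rw [factor, div_mul_eq_mul_div, ← add_div]
  gcongr ?_ / F.coer
  have h2 : F.bdc * F.normW (w₁ - w₀) * F.normW w
      ≤ F.bdc * F.normW (w₁ - w₀) * ((l + F.bdQ * t) / F.coer) := by gcongr
  have h3 : F.bdQ * (F.bdc * F.normW (w₁ - w₀) * F.normZ z)
      ≤ F.bdQ * (F.bdc * F.normW (w₁ - w₀) * t) := by gcongr
  linarith

variable (F)

/-- Banach's fixed point theorem for `w₀ ↦ w`. The iteration involves only the component in `W`;
multiplier and temperature are read off at the fixed point. -/
theorem exists_isOseen_self [FiniteDimensional ℝ W] [FiniteDimensional ℝ M]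
    [FiniteDimensional ℝ Z] (hA : 0 ≤ F.bdA) (hl : 0 ≤ l) (ht : 0 ≤ t)
    (hL : ∀ v, |L v| ≤ l * F.normW v) (hφ : ∀ r, |φ r| ≤ t * F.normZ r)
    (hk : F.factor l t < 1) : ∃ w m z, F.IsOseen w L φ w m z := by
  choose T m z hT using fun w₀ => F.exists_isOseen hA w₀ L φ
  obtain ⟨w, hw⟩ := F.normW.exists_fixedPoint_of_contracting F.normW_def T hk fun x y => by
    simpa using (hT x).normW_sub_le (hT y) hl ht hL hφ le_rfl le_rfl (by simp) (by simp)
  have h := hT w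
  rw [hw] at h
  exact ⟨w, _, _, h⟩

variable {F}

/-- The solution of the nonlinear problem is a locally Lipschitz function of the data. -/
theorem exists_normW_sub_le (hA : 0 ≤ F.bdA) (hB : 0 ≤ F.bdB)
    (H : F.IsOseen w L φ w m z) (hl : 0 ≤ l) (ht : 0 ≤ t) (hL : ∀ v, |L v| ≤ l * F.normW v)
    (hφ : ∀ r, |φ r| ≤ t * F.normZ r) (hk : F.factor l t < 1) :
    ∃ c, 0 ≤ c ∧ ∀ a, 0 ≤ a → a ≤ 1 → ∀ (L' : W →ₗ[ℝ] ℝ) (φ' : Z →ₗ[ℝ] ℝ)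
      (w' : W) (m' : M) (z' : Z), F.IsOseen w' L' φ' w' m' z' →
      (∀ v, |(L' - L) v| ≤ a * F.normW v) → (∀ r, |(φ' - φ) r| ≤ a * F.normZ r) →
      F.normW (w' - w) + F.normM (m' - m) + F.normZ (z' - z) ≤ c * a := by
  have hw0 : 0 ≤ F.normW w := apply_nonneg _ _
  have hz0 := F.normZ_nonneg z
  have hc := F.bdc_nonneg
  have hQ := F.bdQ_nonneg
  have hC := F.coer_pos
  have hk' : 0 < 1 - F.factor l t := by linarith
  -- Both solutions are linearized at themselves, so the velocity difference occurs on both sides of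
  -- `normW_sub_le`; absorbing it divides by `1 - factor`. The constants `c₂` and `c₃` come from
  -- inserting this into the temperature and multiplier bounds.
  set c₁ : ℝ := ((1 + F.bdQ) / F.coer) / (1 - F.factor l t) with hc₁
  have hc₁0 : 0 ≤ c₁ := by positivity
  set c₂ : ℝ := 1 + F.bdc * c₁ * F.normZ z with hc₂
  set c₃ : ℝ := F.bdB * (1 + F.bdc * c₁ * F.normW w + F.bdA * c₁
    + F.bdc * (F.normW w + c₁) * c₁ + F.bdQ * c₂) with hc₃
  refine ⟨c₁ + c₃ + c₂, by positivity, fun a ha ha1 L' φ' w' m' z' H' hL' hφ' => ?_⟩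
  have e1 : F.normW (w' - w) ≤ c₁ * a := by
    have h := H'.normW_sub_le H hl ht hL hφ ha ha hL' hφ'
    rw [hc₁, div_mul_eq_mul_div, le_div_iff₀ hk']
    have : (a + F.bdQ * a) / F.coer = (1 + F.bdQ) / F.coer * a := by ring
    linarith
  have hd : 0 ≤ F.normW (w' - w) := apply_nonneg _ _
  have e2 : F.normZ (z' - z) ≤ c₂ * a := by
    have h := (H'.sub H).normZ_le (t := a + F.bdc * F.normW (w' - w) * F.normZ z) (by positivity)
      (abs_sub_h_le hφ' _ _)
    have h2 : F.bdc * F.normW (w' - w) * F.normZ z ≤ F.bdc * (c₁ * a) * F.normZ z := by gcongr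
    rw [hc₂]; linarith
  -- The restriction `a ≤ 1` enters here: it bounds the linearization point `w'` of the difference
  -- problem independently of `a`.
  have e3 : F.normW w' ≤ F.normW w + c₁ := by
    have h := map_add_le_add F.normW (w' - w) w
    rw [sub_add_cancel] at h
    nlinarith
  have e4 : F.normM (m' - m) ≤ c₃ * a := by
    have h := (H'.sub H).normM_le (l := a + F.bdc * F.normW (w' - w) * F.normW w) (by positivity)
      hA (abs_sub_c_le hL' _ _)
    refine h.trans ?_
    have h2 : c₃ * a = F.bdB * (a + F.bdc * (c₁ * a) * F.normW w + F.bdA * (c₁ * a)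
      + F.bdc * (F.normW w + c₁) * (c₁ * a) + F.bdQ * (c₂ * a)) := by rw [hc₃]; ring
    rw [h2]
    gcongr
  linarith

/-- The solution of the nonlinear problem is unique. -/
theorem isOseen_self_unique (hA : 0 ≤ F.bdA) (hB : 0 ≤ F.bdB) (hl : 0 ≤ l) (ht : 0 ≤ t)
    (hL : ∀ v, |L v| ≤ l * F.normW v) (hφ : ∀ r, |φ r| ≤ t * F.normZ r) (hk : F.factor l t < 1)
    (hM : ∀ m, 0 ≤ F.normM m)
    (H' : F.IsOseen w' L φ w' m' z') (H : F.IsOseen w L φ w m z) : w' = w ∧ m' = m ∧ z' = z := by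
  obtain ⟨c, -, hc⟩ := exists_normW_sub_le hA hB H hl ht hL hφ hk
  -- Equal data allow `a = 0`, so the sum of the three nonnegative norms is at most zero.
  have h := hc 0 le_rfl zero_le_one L φ w' m' z' H' (by simp) (by simp)
  have h1 : 0 ≤ F.normW (w' - w) := apply_nonneg _ _
  have h2 := hM (m' - m)
  have h3 := F.normZ_nonneg (z' - z)
  refine ⟨sub_eq_zero.1 (F.normW_def _ ?_), sub_eq_zero.1 (F.normM_def _ ?_),
    sub_eq_zero.1 (F.normZ_def _ ?_)⟩ <;> linarith

end CoupledForms
end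

/-! ### Linearity and bounds of the concrete forms -/

noncomputable section

namespace IMHD
open Filter Topology NNReal

variable {d : ℕ} {Ω : Set (Pt d)}

/-- For convection: the product of two `L⁴` functions is paired with an `L²` gradient. -/
instance holderTriple_four_four_two : ENNReal.HolderTriple 4 4 2 := by
  constructor
  rw [← ENNReal.toReal_eq_toReal_iff' (by simp) (by simp), ENNReal.toReal_add (by simp) (by simp)]
  norm_num

/-- For the Lorentz force: a velocity in `L⁶` times a field in `L³` is paired with a current in
`L²`. -/
instance holderTriple_six_three_two : ENNReal.HolderTriple 6 3 2 := by
  constructor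
  rw [← ENNReal.toReal_eq_toReal_iff' (by simp) (by simp), ENNReal.toReal_add (by simp) (by simp)]
  norm_num

theorem integral_eq_add_of_ae {α : Type*} [MeasurableSpace α] {μ : Measure α} {F F₁ F₂ : α → ℝ}
    (h₁ : Integrable F₁ μ) (h₂ : Integrable F₂ μ) (h : ∀ᵐ x ∂μ, F x = F₁ x + F₂ x) :
    ∫ x, F x ∂μ = ∫ x, F₁ x ∂μ + ∫ x, F₂ x ∂μ := by
  rw [integral_congr_ae h, integral_add h₁ h₂]

theorem integral_eq_mul_of_ae {α : Type*} [MeasurableSpace α] {μ : Measure α} {F F₁ : α → ℝ}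
    (c : ℝ) (h : ∀ᵐ x ∂μ, F x = c * F₁ x) : ∫ x, F x ∂μ = c * ∫ x, F₁ x ∂μ := by
  rw [integral_congr_ae h, integral_const_mul]

/-! ### Linearity of the coefficient fields -/

theorem fn_add_ae (r s : SpZ Ω) : ∀ᵐ x ∂volume.restrict Ω, fn (r + s) x = fn r x + fn s x :=
  Lp.coeFn_add (fn r) (fn s)

theorem fn_smul_ae (c : ℝ) (r : SpZ Ω) : ∀ᵐ x ∂volume.restrict Ω, fn (c • r) x = c * fn r x :=
  Lp.coeFn_smul c (fn r)

theorem grad_add (r s : SpZ Ω) : grad (r + s) = grad r + grad s := rfl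

theorem grad_smul (c : ℝ) (r : SpZ Ω) : grad (c • r) = c • grad r := rfl

theorem grad_add_ae (r s : SpZ Ω) :
    ∀ᵐ x ∂volume.restrict Ω, grad (r + s) x = grad r x + grad s x :=
  Lp.coeFn_add (grad r) (grad s)

theorem grad_smul_ae (c : ℝ) (r : SpZ Ω) :
    ∀ᵐ x ∂volume.restrict Ω, grad (c • r) x = c • grad r x :=
  Lp.coeFn_smul c (grad r)

theorem vec_add_ae (u v : SpX Ω) : ∀ᵐ x ∂volume.restrict Ω, vec (u + v) x = vec u x + vec v x := by
  filter_upwards [ae_all_iff.2 fun i => fn_add_ae (u i) (v i)] with x hx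
  ext i
  exact hx i

theorem vec_smul_ae (c : ℝ) (u : SpX Ω) :
    ∀ᵐ x ∂volume.restrict Ω, vec (c • u) x = c • vec u x := by
  filter_upwards [ae_all_iff.2 fun i => fn_smul_ae c (u i)] with x hx
  ext i
  exact hx i

theorem divX_add_ae (u v : SpX Ω) :
    ∀ᵐ x ∂volume.restrict Ω, divX (u + v) x = divX u x + divX v x := by
  filter_upwards [ae_all_iff.2 fun i => grad_add_ae (u i) (v i)] with x hx
  simp only [divX, Pi.add_apply, hx, PiLp.add_apply, Finset.sum_add_distrib]

theorem divX_smul_ae (c : ℝ) (u : SpX Ω) :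
    ∀ᵐ x ∂volume.restrict Ω, divX (c • u) x = c * divX u x := by
  filter_upwards [ae_all_iff.2 fun i => grad_smul_ae c (u i)] with x hx
  simp only [divX, Pi.smul_apply, hx, PiLp.smul_apply, smul_eq_mul, Finset.mul_sum]

theorem fld_add (K M : SpY Ω) : fld (K + M) = fld K + fld M := rfl

theorem fld_smul (c : ℝ) (K : SpY Ω) : fld (c • K) = c • fld K := rfl

theorem divY_add (K M : SpY Ω) : divY (K + M) = divY K + divY M := rfl

theorem divY_smul (c : ℝ) (K : SpY Ω) : divY (c • K) = c • divY K := rfl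

theorem fld_add_ae (K M : SpY Ω) : ∀ᵐ x ∂volume.restrict Ω, fld (K + M) x = fld K x + fld M x :=
  Lp.coeFn_add (fld K) (fld M)

theorem fld_smul_ae (c : ℝ) (K : SpY Ω) : ∀ᵐ x ∂volume.restrict Ω, fld (c • K) x = c • fld K x :=
  Lp.coeFn_smul c (fld K)

theorem pad_add (v w : Pt d) : pad (v + w) = pad v + pad w := by
  ext i
  simp only [pad, Pi.add_apply]
  split <;> simp

theorem pad_smul (c : ℝ) (v : Pt d) : pad (c • v) = c • pad v := by
  ext i
  simp only [pad, Pi.smul_apply]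
  split <;> simp

theorem memLp_pad {p : ℝ≥0∞} {f : Pt d → Pt d} (hf : MemLp f p (volume.restrict Ω)) (i : Fin 3) :
    MemLp (fun x => pad (f x) i) p (volume.restrict Ω) := by
  simp only [pad]
  split
  · exact hf.eval_piLp _
  · exact MemLp.zero

/-! ### The convection forms -/

section convection

variable (hd : d = 2 ∨ d = 3) (hΩb : Bornology.IsBounded Ω)
include hd hΩb

theorem memLp_two_mul (u : SpX Ω) (r : SpZ Ω) :
    MemLp (fun x => ‖vec u x‖ * ‖fn r x‖) 2 (volume.restrict Ω) :=
  MemLp.mul' (memLp_fn hd hΩb (p := 4) (by simp) (by norm_num) r).norm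
    (memLp_vec hd hΩb (p := 4) (by norm_num) (by norm_num) u).norm

omit hd hΩb in
theorem aestronglyMeasurable_convZ (u : SpX Ω) (θ r : SpZ Ω) :
    AEStronglyMeasurable (fun x => inner ℝ (vec u x) (grad θ x) * fn r x) (volume.restrict Ω) :=
  ((aestronglyMeasurable_vec u).inner (Lp.aestronglyMeasurable _)).mul
    (Lp.aestronglyMeasurable _)

omit hd hΩb in
theorem norm_convZ_le (u : SpX Ω) (θ r : SpZ Ω) (x : Pt d) :
    ‖inner ℝ (vec u x) (grad θ x) * fn r x‖ ≤ (‖vec u x‖ * ‖fn r x‖) * ‖grad θ x‖ := by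
  rw [norm_mul, mul_right_comm]
  gcongr
  exact norm_inner_le_norm _ _

/-- Needed for additivity: the integral of a nonintegrable function is `0` by convention, so
linearity is not automatic. -/
theorem integrable_convZ (u : SpX Ω) (θ r : SpZ Ω) :
    Integrable (fun x => inner ℝ (vec u x) (grad θ x) * fn r x) (volume.restrict Ω) := by
  have h : Integrable (fun x => (‖vec u x‖ * ‖fn r x‖) * ‖grad θ x‖) (volume.restrict Ω) :=
    (memLp_two_mul hd hΩb u r).integrable_mul (Lp.memLp (grad θ)).norm
  exact h.mono' (aestronglyMeasurable_convZ u θ r)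
    (Eventually.of_forall (norm_convZ_le u θ r))

omit hd hΩb in
theorem le_ofReal_sqrt_mul {a : ℝ≥0∞} {c t : ℝ} (hc : 0 ≤ c) (ht : 0 ≤ t)
    (h : a ^ 2 ≤ ENNReal.ofReal (c * t ^ 2)) : a ≤ ENNReal.ofReal (√c * t) := by
  have h1 : c * t ^ 2 = (√c * t) ^ 2 := by rw [mul_pow, Real.sq_sqrt hc]
  rw [h1, ENNReal.ofReal_pow (by positivity)] at h
  exact (ENNReal.pow_le_pow_left_iff two_ne_zero).1 h

/-- Hölder with exponents `4`, `2`, `4`; each of the two `L⁴` norms contributes `√λ₂`. -/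
theorem abs_convZ_le (u : SpX Ω) (θ r : SpZ Ω) :
    |convZ u θ r| ≤ lam2 Ω * gradNorm u * ‖grad θ‖ * ‖grad r‖ := by
  obtain ⟨h0, hv, hz⟩ := lam2_spec (Ω := Ω) hd hΩb
  have hu := gradNorm_nonneg u
  have h1 : ‖convZ u θ r‖ₑ ≤
      eLpNorm (vec u) 4 (volume.restrict Ω) * eLpNorm (fn r) 4 (volume.restrict Ω) * ‖grad θ‖ₑ :=
    calc ‖convZ u θ r‖ₑ
        ≤ eLpNorm (fun x => inner ℝ (vec u x) (grad θ x) * fn r x) 1 (volume.restrict Ω) := by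
          rw [eLpNorm_one_eq_lintegral_enorm]
          exact enorm_integral_le_lintegral_enorm _
      _ ≤ eLpNorm ((fun x => ‖vec u x‖ * ‖fn r x‖) • fun x => ‖grad θ x‖) 1
            (volume.restrict Ω) := eLpNorm_mono_real (norm_convZ_le u θ r)
      _ ≤ eLpNorm (fun x => ‖vec u x‖ * ‖fn r x‖) 2 (volume.restrict Ω) * ‖grad θ‖ₑ := by
          refine (eLpNorm_smul_le_mul_eLpNorm (p := 2) (q := 2)
            (Lp.aestronglyMeasurable (grad θ)).norm (memLp_two_mul hd hΩb u r).1).trans ?_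
          rw [eLpNorm_norm, ← Lp.enorm_def]
      _ ≤ _ := by
          gcongr
          refine (eLpNorm_smul_le_mul_eLpNorm (p := 4) (q := 4)
            (Lp.aestronglyMeasurable (fn r)).norm (aestronglyMeasurable_vec u).norm).trans ?_
          rw [eLpNorm_norm, eLpNorm_norm]
  have h2 := h1.trans (mul_le_mul_left (mul_le_mul' (le_ofReal_sqrt_mul h0 hu (hv u))
    (le_ofReal_sqrt_mul h0 (norm_nonneg _) (hz r))) _)
  rw [← ofReal_norm, ← ofReal_norm, ← ENNReal.ofReal_mul (by positivity),
    ← ENNReal.ofReal_mul (by positivity), ENNReal.ofReal_le_ofReal_iff (by positivity)] at h2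
  refine h2.trans (le_of_eq ?_)
  linear_combination (gradNorm u * ‖grad θ‖ * ‖grad r‖) * Real.mul_self_sqrt h0

theorem convZ_add_left (u v : SpX Ω) (θ r : SpZ Ω) :
    convZ (u + v) θ r = convZ u θ r + convZ v θ r := by
  refine integral_eq_add_of_ae (integrable_convZ hd hΩb _ _ _) (integrable_convZ hd hΩb _ _ _) ?_
  filter_upwards [vec_add_ae u v] with x hx
  rw [hx, inner_add_left, add_mul]

theorem convZ_add_mid (u : SpX Ω) (θ η r : SpZ Ω) :
    convZ u (θ + η) r = convZ u θ r + convZ u η r := by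
  refine integral_eq_add_of_ae (integrable_convZ hd hΩb _ _ _) (integrable_convZ hd hΩb _ _ _) ?_
  filter_upwards [grad_add_ae θ η] with x hx
  rw [hx, inner_add_right, add_mul]

theorem convZ_add_right (u : SpX Ω) (θ r s : SpZ Ω) :
    convZ u θ (r + s) = convZ u θ r + convZ u θ s := by
  refine integral_eq_add_of_ae (integrable_convZ hd hΩb _ _ _) (integrable_convZ hd hΩb _ _ _) ?_
  filter_upwards [fn_add_ae r s] with x hx
  rw [hx, mul_add]

omit hd hΩb in
theorem convZ_smul_left (c : ℝ) (u : SpX Ω) (θ r : SpZ Ω) :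
    convZ (c • u) θ r = c * convZ u θ r := by
  refine integral_eq_mul_of_ae c ?_
  filter_upwards [vec_smul_ae c u] with x hx
  rw [hx, real_inner_smul_left, mul_assoc]

omit hd hΩb in
theorem convZ_smul_mid (c : ℝ) (u : SpX Ω) (θ r : SpZ Ω) :
    convZ u (c • θ) r = c * convZ u θ r := by
  refine integral_eq_mul_of_ae c ?_
  filter_upwards [grad_smul_ae c θ] with x hx
  rw [hx, real_inner_smul_right, mul_assoc]

omit hd hΩb in
theorem convZ_smul_right (c : ℝ) (u : SpX Ω) (θ r : SpZ Ω) :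
    convZ u θ (c • r) = c * convZ u θ r := by
  refine integral_eq_mul_of_ae c ?_
  filter_upwards [fn_smul_ae c r] with x hx
  rw [hx]; ring

theorem convX_eq_sum (u v w : SpX Ω) : convX u v w = ∑ i, convZ u (v i) (w i) :=
  integral_finsetSum _ fun _ _ => integrable_convZ hd hΩb _ _ _

omit hd hΩb in
theorem gradNorm_sq (v : SpX Ω) : gradNorm v ^ 2 = ∑ i, ‖grad (v i)‖ ^ 2 :=
  Real.sq_sqrt (Finset.sum_nonneg fun _ _ => sq_nonneg _)

omit hd hΩb in
theorem sum_norm_grad_mul_le (v w : SpX Ω) :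
    ∑ i, ‖grad (v i)‖ * ‖grad (w i)‖ ≤ gradNorm v * gradNorm w :=
  Real.sum_mul_le_sqrt_mul_sqrt _ _ _

/-- Cauchy–Schwarz over the components keeps the scalar constant `λ₂`, with no factor depending on
`d`. -/
theorem abs_convX_le (u v w : SpX Ω) :
    |convX u v w| ≤ lam2 Ω * gradNorm u * gradNorm v * gradNorm w := by
  have h0 := (lam2_spec (Ω := Ω) hd hΩb).1
  have hu := gradNorm_nonneg u
  rw [convX_eq_sum hd hΩb]
  calc |∑ i, convZ u (v i) (w i)|
      ≤ ∑ i, |convZ u (v i) (w i)| := Finset.abs_sum_le_sum_abs _ _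
    _ ≤ ∑ i, lam2 Ω * gradNorm u * (‖grad (v i)‖ * ‖grad (w i)‖) :=
        Finset.sum_le_sum fun i _ => (abs_convZ_le hd hΩb _ _ _).trans_eq (by ring)
    _ = lam2 Ω * gradNorm u * ∑ i, ‖grad (v i)‖ * ‖grad (w i)‖ := by rw [Finset.mul_sum]
    _ ≤ lam2 Ω * gradNorm u * (gradNorm v * gradNorm w) := by
        gcongr; exact sum_norm_grad_mul_le v w
    _ = _ := by ring

/-- The trilinear form `h`. -/
def formHLin : SpX Ω →ₗ[ℝ] SpZ Ω →ₗ[ℝ] SpZ Ω →ₗ[ℝ] ℝ where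
  toFun u := LinearMap.mk₂ ℝ (formH u)
    (by intros; simp only [formH, convZ_add_mid hd hΩb, convZ_add_right hd hΩb]; ring)
    (by intros; simp only [formH, convZ_smul_mid, convZ_smul_right, smul_eq_mul]; ring)
    (by intros; simp only [formH, convZ_add_mid hd hΩb, convZ_add_right hd hΩb]; ring)
    (by intros; simp only [formH, convZ_smul_mid, convZ_smul_right, smul_eq_mul]; ring)
  map_add' u v := LinearMap.ext₂ fun θ r => by
    simp only [LinearMap.mk₂_apply, LinearMap.add_apply, formH, convZ_add_left hd hΩb]; ring
  map_smul' c u := LinearMap.ext₂ fun θ r => by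
    simp only [LinearMap.mk₂_apply, LinearMap.smul_apply, formH, convZ_smul_left, smul_eq_mul,
      RingHom.id_apply]; ring

/-- Velocity convection acts on each component as heat convection does, so its linearity is
inherited from `h`. -/
theorem formA1_eq_sum (u v w : SpX Ω) : formA1 u v w = ∑ i, formH u (v i) (w i) := by
  simp only [formA1, formH, convX_eq_sum hd hΩb, Finset.mul_sum, Finset.sum_sub_distrib]

/-- The trilinear form `c`. -/
def formA1Lin : SpX Ω →ₗ[ℝ] SpX Ω →ₗ[ℝ] SpX Ω →ₗ[ℝ] ℝ where
  toFun u := LinearMap.mk₂ ℝ (fun v w => ∑ i, formHLin hd hΩb u (v i) (w i))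
    (by intros; simp [Finset.sum_add_distrib])
    (by intros; simp [Finset.mul_sum])
    (by intros; simp [Finset.sum_add_distrib])
    (by intros; simp [Finset.mul_sum])
  map_add' u v := LinearMap.ext₂ fun θ r => by simp [Finset.sum_add_distrib]
  map_smul' c u := LinearMap.ext₂ fun θ r => by simp [Finset.mul_sum]

theorem formA1Lin_apply (u v w : SpX Ω) : formA1Lin hd hΩb u v w = formA1 u v w :=
  (formA1_eq_sum hd hΩb u v w).symm

theorem abs_formH_le (u : SpX Ω) (θ r : SpZ Ω) :
    |formH u θ r| ≤ lam2 Ω * gradNorm u * ‖grad θ‖ * ‖grad r‖ := by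
  have h1 := abs_le.1 (abs_convZ_le hd hΩb u θ r)
  have h2 := abs_le.1 (abs_convZ_le hd hΩb u r θ)
  rw [formH, abs_le]
  constructor <;> linarith

theorem abs_formA1_le (u v w : SpX Ω) :
    |formA1 u v w| ≤ lam2 Ω * gradNorm u * gradNorm v * gradNorm w := by
  have h1 := abs_le.1 (abs_convX_le hd hΩb u v w)
  have h2 := abs_le.1 (abs_convX_le hd hΩb u w v)
  rw [formA1, abs_le]
  constructor <;> linarith

end convection

/-! ### The buoyancy form, the pressure form and the coupling form -/

theorem memLp_two_vec (v : SpX Ω) : MemLp (vec v) 2 (volume.restrict Ω) :=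
  MemLp.of_eval_piLp fun i => Lp.memLp (fn (v i))

theorem memLp_two_divX (v : SpX Ω) : MemLp (divX v) 2 (volume.restrict Ω) :=
  memLp_finsetSum _ fun i _ => (Lp.memLp (grad (v i))).eval_piLp i

variable (P : Params d)

theorem integrable_formQ (θ : SpZ Ω) (v : SpX Ω) :
    Integrable (fun x => inner ℝ (fn θ x • P.dir) (vec v x)) (volume.restrict Ω) := by
  have h : Integrable (fun x => fn θ x * inner ℝ P.dir (vec v x)) (volume.restrict Ω) :=
    (Lp.memLp (fn θ)).integrable_mul ((memLp_two_vec v).const_inner P.dir)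
  simpa only [real_inner_smul_left] using h

/-- Poincaré's inequality is applied to the temperature and to the velocity, whence the square of
`C_Ω` in `λ_q`. -/
theorem abs_formQ_le (hd : d = 2 ∨ d = 3) (hΩb : Bornology.IsBounded Ω) (hPr : 0 < P.Pr)
    (hRa : 0 ≤ P.Ra) (hdir : ‖P.dir‖ = 1) (θ : SpZ Ω) (v : SpX Ω) :
    |formQ P θ v| ≤ lamQ Ω P * ‖grad θ‖ * gradNorm v := by
  obtain ⟨h0, hv, hz⟩ := cOmega_spec (Ω := Ω) hd hΩb
  have hu := gradNorm_nonneg v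
  have h1 : ‖∫ x in Ω, inner ℝ (fn θ x • P.dir) (vec v x)‖ₑ ≤
      ‖fn θ‖ₑ * eLpNorm (vec v) 2 (volume.restrict Ω) :=
    calc _ ≤ eLpNorm (fun x => inner ℝ (fn θ x • P.dir) (vec v x)) 1 (volume.restrict Ω) := by
          rw [eLpNorm_one_eq_lintegral_enorm]
          exact enorm_integral_le_lintegral_enorm _
      _ ≤ eLpNorm ((fun x => ‖fn θ x‖) • fun x => ‖vec v x‖) 1 (volume.restrict Ω) := by
          refine eLpNorm_mono_real fun x => (norm_inner_le_norm _ _).trans_eq ?_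
          simp [norm_smul, hdir]
      _ ≤ _ := by
          refine (eLpNorm_smul_le_mul_eLpNorm (p := 2) (q := 2)
            (aestronglyMeasurable_vec v).norm (Lp.aestronglyMeasurable (fn θ)).norm).trans ?_
          rw [eLpNorm_norm, eLpNorm_norm, Lp.enorm_def]
  have h2 := h1.trans (mul_le_mul_right (hv v) _)
  rw [← ofReal_norm, ← ofReal_norm, ← ENNReal.ofReal_mul (by positivity),
    ENNReal.ofReal_le_ofReal_iff (by positivity), Real.norm_eq_abs] at h2
  have h3 : 0 ≤ P.Pr * P.Ra := by positivity
  rw [formQ, abs_mul, abs_neg, abs_of_nonneg h3, lamQ]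
  calc _ ≤ P.Pr * P.Ra * ((cOmega Ω * ‖grad θ‖) * (cOmega Ω * gradNorm v)) := by
        gcongr
        exact h2.trans (by gcongr; exact hz θ)
    _ = _ := by ring

/-- The bilinear form `𝒬`. -/
def formQLin : SpZ Ω →ₗ[ℝ] SpX Ω →ₗ[ℝ] ℝ :=
  LinearMap.mk₂ ℝ (formQ P)
    (fun θ η v => by
      rw [formQ, formQ, formQ, ← mul_add]
      congr 1
      refine integral_eq_add_of_ae (integrable_formQ P _ _) (integrable_formQ P _ _) ?_
      filter_upwards [fn_add_ae θ η] with x hx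
      rw [hx, add_smul, inner_add_left])
    (fun c θ v => by
      rw [formQ, formQ, smul_eq_mul, mul_left_comm]
      congr 1
      refine integral_eq_mul_of_ae c ?_
      filter_upwards [fn_smul_ae c θ] with x hx
      rw [hx, mul_smul, real_inner_smul_left])
    (fun θ u v => by
      rw [formQ, formQ, formQ, ← mul_add]
      congr 1
      refine integral_eq_add_of_ae (integrable_formQ P _ _) (integrable_formQ P _ _) ?_
      filter_upwards [vec_add_ae u v] with x hx
      rw [hx, inner_add_right])
    (fun c θ v => by
      rw [formQ, formQ, smul_eq_mul, mul_left_comm]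
      congr 1
      refine integral_eq_mul_of_ae c ?_
      filter_upwards [vec_smul_ae c v] with x hx
      rw [hx, real_inner_smul_right])

theorem integrable_bS (q : L2 Ω ℝ) (v : SpX Ω) :
    Integrable (fun x => q x * divX v x) (volume.restrict Ω) :=
  (Lp.memLp q).integrable_mul (memLp_two_divX v)

/-- The bilinear form `b_s`. -/
def bSLin : L2 Ω ℝ →ₗ[ℝ] SpX Ω →ₗ[ℝ] ℝ :=
  LinearMap.mk₂ ℝ (bS P)
    (fun q p v => by
      rw [bS, bS, bS, ← mul_add]
      congr 1
      refine integral_eq_add_of_ae (integrable_bS _ _) (integrable_bS _ _) ?_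
      filter_upwards [Lp.coeFn_add q p] with x hx
      rw [hx, Pi.add_apply, add_mul])
    (fun c q v => by
      rw [bS, bS, smul_eq_mul, mul_left_comm]
      congr 1
      refine integral_eq_mul_of_ae c ?_
      filter_upwards [Lp.coeFn_smul c q] with x hx
      rw [hx, Pi.smul_apply, smul_eq_mul, mul_assoc])
    (fun q u v => by
      rw [bS, bS, bS, ← mul_add]
      congr 1
      refine integral_eq_add_of_ae (integrable_bS _ _) (integrable_bS _ _) ?_
      filter_upwards [divX_add_ae u v] with x hx
      rw [hx, mul_add])
    (fun c q v => by
      rw [bS, bS, smul_eq_mul, mul_left_comm]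
      congr 1
      refine integral_eq_mul_of_ae c ?_
      filter_upwards [divX_smul_ae c v] with x hx
      rw [hx, mul_left_comm])

/-- The triple product expands into products of an `L²`, an `L³` and an `L⁶` component, and `1/2 +
1/3 + 1/6 = 1`. -/
theorem integrable_dForm (hd : d = 2 ∨ d = 3) (hΩb : Bornology.IsBounded Ω)
    (hB : MemLp P.B 3 (volume.restrict Ω)) (K : SpY Ω) (v : SpX Ω) :
    Integrable (fun x => (pad (fld K x) ⨯₃ (P.B x).ofLp) ⬝ᵥ pad (vec v x))
      (volume.restrict Ω) := by
  have h : ∀ i j k : Fin 3, Integrable (fun x => pad (fld K x) i * (P.B x).ofLp j * pad (vec v x) k)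
      (volume.restrict Ω) := fun i j k => by
    have h1 : MemLp (fun x => pad (vec v x) k * (P.B x).ofLp j) 2 (volume.restrict Ω) :=
      MemLp.mul' (p := 6) (q := 3) (hB.eval_piLp j)
        (memLp_pad (memLp_vec hd hΩb (by norm_num) le_rfl v) k)
    exact ((memLp_pad (Lp.memLp (fld K)) i).integrable_mul h1).congr
      (Eventually.of_forall fun x => by simp only [Pi.mul_apply]; ring)
  simp only [cross_apply, dotProduct, Fin.sum_univ_three, Matrix.cons_val, sub_mul]
  exact (((h 1 2 0).sub (h 2 1 0)).add ((h 2 0 1).sub (h 0 2 1))).add ((h 0 1 2).sub (h 1 0 2))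

/-- The bilinear form `d`. -/
def dFormLin (hd : d = 2 ∨ d = 3) (hΩb : Bornology.IsBounded Ω)
    (hB : MemLp P.B 3 (volume.restrict Ω)) : SpY Ω →ₗ[ℝ] SpX Ω →ₗ[ℝ] ℝ :=
  LinearMap.mk₂ ℝ (dForm P)
    (fun K M v => by
      rw [dForm, dForm, dForm, ← mul_add]
      congr 1
      refine integral_eq_add_of_ae (integrable_dForm P hd hΩb hB _ _)
        (integrable_dForm P hd hΩb hB _ _) ?_
      filter_upwards [fld_add_ae K M] with x hx
      rw [hx, pad_add, map_add, LinearMap.add_apply, add_dotProduct])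
    (fun c K v => by
      rw [dForm, dForm, smul_eq_mul, mul_left_comm]
      congr 1
      refine integral_eq_mul_of_ae c ?_
      filter_upwards [fld_smul_ae c K] with x hx
      rw [hx, pad_smul, map_smul, LinearMap.smul_apply, smul_dotProduct, smul_eq_mul])
    (fun K u v => by
      rw [dForm, dForm, dForm, ← mul_add]
      congr 1
      refine integral_eq_add_of_ae (integrable_dForm P hd hΩb hB _ _)
        (integrable_dForm P hd hΩb hB _ _) ?_
      filter_upwards [vec_add_ae u v] with x hx
      rw [hx, pad_add, dotProduct_add])
    (fun c K v => by
      rw [dForm, dForm, smul_eq_mul, mul_left_comm]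
      congr 1
      refine integral_eq_mul_of_ae c ?_
      filter_upwards [vec_smul_ae c v] with x hx
      rw [hx, pad_smul, dotProduct_smul, smul_eq_mul])

end IMHD
end

/-! ### The discrete problem as an instance of the abstract one -/

noncomputable section

namespace IMHD
open Filter Topology NNReal

variable {d : ℕ} {Ω : Set (Pt d)}

/-! ### Norms -/

theorem divNorm_nonneg (K : SpY Ω) : 0 ≤ divNorm K := Real.sqrt_nonneg _

theorem divNorm_sq (K : SpY Ω) : divNorm K ^ 2 = ‖fld K‖ ^ 2 + ‖divY K‖ ^ 2 :=
  Real.sq_sqrt (by positivity)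

theorem norm_fld_le_divNorm (K : SpY Ω) : ‖fld K‖ ≤ divNorm K :=
  Real.le_sqrt_of_sq_le (by nlinarith [sq_nonneg ‖divY K‖])

theorem energyNorm_nonneg (v : SpX Ω) (K : SpY Ω) : 0 ≤ energyNorm v K := Real.sqrt_nonneg _

theorem energyNorm_sq (v : SpX Ω) (K : SpY Ω) :
    energyNorm v K ^ 2 = gradNorm v ^ 2 + divNorm K ^ 2 :=
  Real.sq_sqrt (by positivity)

theorem gradNorm_le_energyNorm (v : SpX Ω) (K : SpY Ω) : gradNorm v ≤ energyNorm v K :=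
  Real.le_sqrt_of_sq_le (by nlinarith [sq_nonneg (divNorm K)])

theorem divNorm_le_energyNorm (v : SpX Ω) (K : SpY Ω) : divNorm K ≤ energyNorm v K :=
  Real.le_sqrt_of_sq_le (by nlinarith [sq_nonneg (gradNorm v)])

theorem gradNorm_zero : gradNorm (0 : SpX Ω) = 0 := by
  have h : grad (0 : SpZ Ω) = 0 := rfl
  simp [gradNorm, h]

theorem divNorm_zero : divNorm (0 : SpY Ω) = 0 := by
  have h1 : fld (0 : SpY Ω) = 0 := rfl
  have h2 : divY (0 : SpY Ω) = 0 := rfl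
  simp [divNorm, h1, h2]

theorem energyNorm_zero_right (v : SpX Ω) : energyNorm v 0 = gradNorm v := by
  rw [energyNorm, divNorm_zero]
  simpa using Real.sqrt_sq (gradNorm_nonneg v)

theorem energyNorm_zero_left (K : SpY Ω) : energyNorm 0 K = divNorm K := by
  rw [energyNorm, gradNorm_zero]
  simpa using Real.sqrt_sq (divNorm_nonneg K)

theorem gradNorm_neg (v : SpX Ω) : gradNorm (-v) = gradNorm v := by
  have h : ∀ r : SpZ Ω, grad (-r) = - grad r := fun _ => rfl
  simp [gradNorm, h]

theorem eq_zero_of_divNorm_eq_zero {K : SpY Ω} (h : divNorm K = 0) : K = 0 := by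
  have h1 := divNorm_sq K
  rw [h] at h1
  have h2 : ‖fld K‖ = 0 := by nlinarith [sq_nonneg ‖fld K‖, sq_nonneg ‖divY K‖]
  have h3 : ‖divY K‖ = 0 := by nlinarith [sq_nonneg ‖fld K‖, sq_nonneg ‖divY K‖]
  exact Subtype.ext (Prod.ext (norm_eq_zero.1 h2) (norm_eq_zero.1 h3))

theorem eq_zero_of_gradNorm_eq_zero (hd : d = 2 ∨ d = 3) (hΩb : Bornology.IsBounded Ω)
    {v : SpX Ω} (h : gradNorm v = 0) : v = 0 := by
  have := norm_le_gradNorm hd hΩb v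
  rw [h, mul_zero] at this
  exact norm_le_zero_iff.1 this

theorem eq_zero_of_energyNorm_eq_zero (hd : d = 2 ∨ d = 3) (hΩb : Bornology.IsBounded Ω)
    {v : SpX Ω} {K : SpY Ω} (h : energyNorm v K = 0) : v = 0 ∧ K = 0 := by
  have h1 := gradNorm_le_energyNorm v K
  have h2 := divNorm_le_energyNorm v K
  rw [h] at h1 h2
  exact ⟨eq_zero_of_gradNorm_eq_zero hd hΩb (le_antisymm h1 (gradNorm_nonneg v)),
    eq_zero_of_divNorm_eq_zero (le_antisymm h2 (divNorm_nonneg K))⟩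

/-- The Hilbert space which measures a pair `(v, K)` by its energy norm. -/
abbrev EnergySpace (Ω : Set (Pt d)) : Type :=
  WithLp 2 (PiLp 2 (fun _ : Fin d => L2 Ω (Pt d)) × WithLp 2 (L2 Ω (Pt d) × L2 Ω ℝ))

/-- The map `(v, K) ↦ (∇v, (K, ∇·K))`. -/
def toEnergySpace : (SpX Ω × SpY Ω) →ₗ[ℝ] EnergySpace Ω where
  toFun w := WithLp.toLp 2 (WithLp.toLp 2 fun i => grad (w.1 i),
    WithLp.toLp 2 (fld w.2, divY w.2))
  map_add' _ _ := rfl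
  map_smul' _ _ := rfl

/-- As the pullback of a Hilbert space norm, the energy norm obtains the triangle inequality and
homogeneity for free. -/
theorem norm_toEnergySpace (v : SpX Ω) (K : SpY Ω) : ‖toEnergySpace (v, K)‖ = energyNorm v K := by
  have h1 : ‖(WithLp.toLp 2 fun i => grad (v i) : PiLp 2 (fun _ : Fin d => L2 Ω (Pt d)))‖
      = gradNorm v := PiLp.norm_eq_of_L2 _
  have h2 : ‖(WithLp.toLp 2 (fld K, divY K) : WithLp 2 (L2 Ω (Pt d) × L2 Ω ℝ))‖ = divNorm K :=
    WithLp.prod_norm_eq_of_L2 _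
  rw [WithLp.prod_norm_eq_of_L2, energyNorm, ← h1, ← h2]
  rfl

/-- The energy norm on a discrete space. -/
def Spaces.energySeminorm (V : Spaces Ω) : Seminorm ℝ (V.Xh × V.Yh) :=
  let ι : (V.Xh × V.Yh) →ₗ[ℝ] EnergySpace Ω :=
    toEnergySpace ∘ₗ LinearMap.prodMap V.Xh.subtype V.Yh.subtype
  Seminorm.comp (E := V.Xh × V.Yh) (normSeminorm ℝ (EnergySpace Ω)) ι

theorem Spaces.energySeminorm_apply (V : Spaces Ω) (w : V.Xh × V.Yh) :
    V.energySeminorm w = energyNorm w.1.1 w.2.1 :=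
  norm_toEnergySpace _ _

/-! ### Linear forms and right-hand sides -/

section linear

variable (P : Params d) (D : Source Ω)

theorem dualNormX_spec (hd : d = 2 ∨ d = 3) (hΩb : Bornology.IsBounded Ω) (f : SpX Ω →L[ℝ] ℝ) :
    0 ≤ dualNormX f ∧ ∀ v, |f v| ≤ dualNormX f * gradNorm v := by
  have h0 := (cOmega_spec (Ω := Ω) hd hΩb).1
  exact abs_le_iSup_div_mul gradNorm (by positivity) (norm_le_gradNorm hd hΩb) gradNorm_zero
    gradNorm_neg f

theorem dualNormZ_spec (hd : d = 2 ∨ d = 3) (hΩb : Bornology.IsBounded Ω) (f : SpZ Ω →L[ℝ] ℝ) :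
    0 ≤ dualNormZ f ∧ ∀ r, |f r| ≤ dualNormZ f * ‖grad r‖ := by
  have h0 := (cOmega_spec (Ω := Ω) hd hΩb).1
  exact abs_le_iSup_div_mul (fun r => ‖grad r‖) (by positivity) (norm_le_norm_grad hd hΩb)
    (norm_zero (E := L2 Ω (Pt d))) (fun r => norm_neg (grad r)) f

theorem abs_formL_le (hd : d = 2 ∨ d = 3) (hΩb : Bornology.IsBounded Ω) (hκ : 0 < P.kappa)
    (v : SpX Ω) (K : SpY Ω) :
    |formL P D v K| ≤ dualNormX D.f * gradNorm v + P.kappa * ‖D.g‖ * divNorm K := by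
  refine (abs_add_le _ _).trans (add_le_add ((dualNormX_spec hd hΩb D.f).2 v) ?_)
  rw [abs_mul, abs_of_pos hκ, mul_assoc]
  gcongr
  exact (abs_real_inner_le_norm _ _).trans (by gcongr; exact norm_fld_le_divNorm K)

theorem abs_formL_le_normL (hd : d = 2 ∨ d = 3) (hΩb : Bornology.IsBounded Ω) (hκ : 0 < P.kappa)
    (v : SpX Ω) (K : SpY Ω) : |formL P D v K| ≤ normL P D * energyNorm v K := by
  refine (abs_formL_le P D hd hΩb hκ v K).trans ?_
  rw [normL, energyNorm, ← Real.sqrt_mul (by positivity)]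
  refine Real.le_sqrt_of_sq_le ?_
  -- Cauchy–Schwarz in `ℝ²`: this square is the difference of the two sides (Lagrange's identity).
  nlinarith [sq_nonneg (dualNormX D.f * divNorm K - P.kappa * ‖D.g‖ * gradNorm v)]

/-- The functional `L` on a discrete space. -/
def Spaces.formLLin (V : Spaces Ω) : (V.Xh × V.Yh) →ₗ[ℝ] ℝ where
  toFun w := formL P D w.1.1 w.2.1
  map_add' w w' := by
    simp only [formL, Prod.fst_add, Prod.snd_add, Submodule.coe_add, map_add, fld_add,
      inner_add_right]
    ring
  map_smul' c w := by
    simp only [formL, Prod.smul_fst, Prod.smul_snd, Submodule.coe_smul, map_smul, fld_smul,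
      real_inner_smul_right, smul_eq_mul, RingHom.id_apply]
    ring

/-- The functional `φ` on a discrete space. -/
def Spaces.heatLin (V : Spaces Ω) : V.Zh →ₗ[ℝ] ℝ := D.heat.toLinearMap ∘ₗ V.Zh.subtype

/-- A perturbation of the data is again a source, so the bound for `L` also measures it. -/
theorem Spaces.formLLin_sub_apply (V : Spaces Ω) (D' : Source Ω) (w : V.Xh × V.Yh) :
    (V.formLLin P D' - V.formLLin P D) w
      = formL P ⟨D'.f - D.f, D'.g - D.g, D'.heat - D.heat⟩ w.1.1 w.2.1 := by
  change formL P D' w.1.1 w.2.1 - formL P D w.1.1 w.2.1 = _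
  simp only [formL, sub_apply, inner_sub_left]
  ring

/-- The bilinear form `𝒜₀` on a discrete space. -/
def Spaces.formA0Lin (V : Spaces Ω) (hd : d = 2 ∨ d = 3) (hΩb : Bornology.IsBounded Ω)
    (hB : MemLp P.B 3 (volume.restrict Ω)) :
    (V.Xh × V.Yh) →ₗ[ℝ] (V.Xh × V.Yh) →ₗ[ℝ] ℝ :=
  have ha : ∀ K L v, dForm P (K + L) v = dForm P K v + dForm P L v :=
    LinearMap.map_add₂ (dFormLin P hd hΩb hB)
  have ha' : ∀ K u v, dForm P K (u + v) = dForm P K u + dForm P K v :=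
    fun K => map_add (dFormLin P hd hΩb hB K)
  have hs : ∀ (c : ℝ) K v, dForm P (c • K) v = c * dForm P K v :=
    LinearMap.map_smul₂ (dFormLin P hd hΩb hB)
  have hs' : ∀ (c : ℝ) K v, dForm P K (c • v) = c * dForm P K v :=
    fun c K => map_smul (dFormLin P hd hΩb hB K) c
  LinearMap.mk₂ ℝ (fun x y => formA0 P x.1.1 x.2.1 y.1.1 y.2.1)
    (by
      intro x x' y
      simp only [formA0, aS, aM, Prod.fst_add, Prod.snd_add, Submodule.coe_add, Pi.add_apply,
        grad_add, fld_add, inner_add_left, Finset.sum_add_distrib, ha, ha']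
      ring)
    (by
      intro c x y
      simp only [formA0, aS, aM, Prod.smul_fst, Prod.smul_snd, Submodule.coe_smul, Pi.smul_apply,
        grad_smul, fld_smul, real_inner_smul_left, ← Finset.mul_sum, hs, hs', smul_eq_mul]
      ring)
    (by
      intro x y y'
      simp only [formA0, aS, aM, Prod.fst_add, Prod.snd_add, Submodule.coe_add, Pi.add_apply,
        grad_add, fld_add, inner_add_right, Finset.sum_add_distrib, ha, ha']
      ring)
    (by
      intro c x y
      simp only [formA0, aS, aM, Prod.smul_fst, Prod.smul_snd, Submodule.coe_smul, Pi.smul_apply,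
        grad_smul, fld_smul, real_inner_smul_right, ← Finset.mul_sum, hs, hs', smul_eq_mul]
      ring)

/-- The bilinear form `ℬ` on a discrete space. -/
def Spaces.formBLin (V : Spaces Ω) : (V.Eh × V.Sh) →ₗ[ℝ] (V.Xh × V.Yh) →ₗ[ℝ] ℝ :=
  have ha : ∀ q p v, bS P (q + p : L2 Ω ℝ) v = bS P q v + bS P p v :=
    LinearMap.map_add₂ (bSLin P)
  have ha' : ∀ q u v, bS P (q : L2 Ω ℝ) (u + v) = bS P q u + bS P q v :=
    fun q => map_add (bSLin P q)
  have hs : ∀ (c : ℝ) q v, bS P (c • q : L2 Ω ℝ) v = c * bS P q v :=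
    LinearMap.map_smul₂ (bSLin P)
  have hs' : ∀ (c : ℝ) q v, bS P (q : L2 Ω ℝ) (c • v) = c * bS P q v :=
    fun c q => map_smul (bSLin P q) c
  LinearMap.mk₂ ℝ (fun m w => formB P m.1.1 m.2.1 w.1.1 w.2.1)
    (by
      intro x x' y
      simp only [formB, bM, Prod.fst_add, Prod.snd_add, Submodule.coe_add, inner_add_left, ha]
      ring)
    (by
      intro c x y
      simp only [formB, bM, Prod.smul_fst, Prod.smul_snd, Submodule.coe_smul,
        real_inner_smul_left, hs, smul_eq_mul]
      ring)
    (by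
      intro x y y'
      simp only [formB, bM, Prod.fst_add, Prod.snd_add, Submodule.coe_add, divY_add,
        inner_add_right, ha']
      ring)
    (by
      intro c x y
      simp only [formB, bM, Prod.smul_fst, Prod.smul_snd, Submodule.coe_smul, divY_smul,
        real_inner_smul_right, hs', smul_eq_mul]
      ring)

/-- The bilinear form `e` on a discrete space. -/
def Spaces.formELin (V : Spaces Ω) : V.Zh →ₗ[ℝ] V.Zh →ₗ[ℝ] ℝ :=
  LinearMap.mk₂ ℝ (fun θ r => formE θ.1 r.1)
    (by intros; simp only [formE, Submodule.coe_add, grad_add, inner_add_left])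
    (by intros; simp only [formE, Submodule.coe_smul, grad_smul, real_inner_smul_left, smul_eq_mul])
    (by intros; simp only [formE, Submodule.coe_add, grad_add, inner_add_right])
    (by
      intros
      simp only [formE, Submodule.coe_smul, grad_smul, real_inner_smul_right, smul_eq_mul])

/-- The trilinear form `𝒜₁` on a discrete space. -/
def Spaces.formA1Lin (V : Spaces Ω) (hd : d = 2 ∨ d = 3) (hΩb : Bornology.IsBounded Ω) :
    (V.Xh × V.Yh) →ₗ[ℝ] (V.Xh × V.Yh) →ₗ[ℝ] (V.Xh × V.Yh) →ₗ[ℝ] ℝ :=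
  let ι : (V.Xh × V.Yh) →ₗ[ℝ] SpX Ω := V.Xh.subtype ∘ₗ LinearMap.fst ℝ V.Xh V.Yh
  { toFun := fun w => (IMHD.formA1Lin hd hΩb (ι w)).compl₁₂ ι ι
    map_add' := fun _ _ => LinearMap.ext₂ fun _ _ => by simp
    map_smul' := fun _ _ => LinearMap.ext₂ fun _ _ => by simp }

/-- The trilinear form `ℋ` on a discrete space. -/
def Spaces.formHLin (V : Spaces Ω) (hd : d = 2 ∨ d = 3) (hΩb : Bornology.IsBounded Ω) :
    (V.Xh × V.Yh) →ₗ[ℝ] V.Zh →ₗ[ℝ] V.Zh →ₗ[ℝ] ℝ :=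
  let ι : (V.Xh × V.Yh) →ₗ[ℝ] SpX Ω := V.Xh.subtype ∘ₗ LinearMap.fst ℝ V.Xh V.Yh
  { toFun := fun w => (IMHD.formHLin hd hΩb (ι w)).compl₁₂ V.Zh.subtype V.Zh.subtype
    map_add' := fun _ _ => LinearMap.ext₂ fun _ _ => by simp
    map_smul' := fun _ _ => LinearMap.ext₂ fun _ _ => by simp }

/-- The bilinear form `𝒬` on a discrete space. -/
def Spaces.formQLin (V : Spaces Ω) : V.Zh →ₗ[ℝ] (V.Xh × V.Yh) →ₗ[ℝ] ℝ :=
  (IMHD.formQLin P).compl₁₂ V.Zh.subtype (V.Xh.subtype ∘ₗ LinearMap.fst ℝ V.Xh V.Yh)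

theorem Spaces.formA1Lin_apply (V : Spaces Ω) (hd : d = 2 ∨ d = 3) (hΩb : Bornology.IsBounded Ω)
    (w u v : V.Xh × V.Yh) : V.formA1Lin hd hΩb w u v = formA1 w.1.1 u.1.1 v.1.1 :=
  IMHD.formA1Lin_apply hd hΩb _ _ _

end linear

/-! ### The inf-sup conditions -/

/-- Every quotient at `q` is at most `k / nM q`, hence so is their supremum, which is at least `β`.
In the extended reals this needs no boundedness or nonemptiness of the family. -/
theorem InfSup.le_of_forall_le {M W : Type*} [Zero M] [Zero W] {b : M → W → ℝ} {nM : M → ℝ}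
    {nW : W → ℝ} {β : ℝ} (h : InfSup b nM nW β) {q : M} (hq : q ≠ 0) (hqM : 0 < nM q)
    (hW : ∀ w, w ≠ 0 → 0 < nW w) {k : ℝ} (hk : ∀ w, b q w ≤ k * nW w) : β * nM q ≤ k := by
  have h1 : (β : EReal) ≤ ((k / nM q : ℝ) : EReal) := by
    refine (h.trans (iInf_le _ ⟨q, hq⟩)).trans (iSup_le fun w => ?_)
    rw [EReal.coe_le_coe_iff, div_le_div_iff₀ (mul_pos (hW _ w.2) hqM) hqM]
    calc _ ≤ k * nW w.1 * nM q := by gcongr; exact hk w.1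
      _ = _ := by ring
  rw [EReal.coe_le_coe_iff, le_div_iff₀ hqM] at h1
  exact h1

section infSup

variable {P : Params d} {V : Spaces Ω} {β k : ℝ}

theorem Spaces.InfSupS.norm_le (h : V.InfSupS P β) (hd : d = 2 ∨ d = 3)
    (hΩb : Bornology.IsBounded Ω) (hβ : 0 < β) (hk0 : 0 ≤ k) (q : V.Eh)
    (hk : ∀ w : V.Xh, bS P (q.1 : L2 Ω ℝ) w.1 ≤ k * gradNorm w.1) : ‖q‖ ≤ 1 / β * k := by
  rw [one_div_mul_eq_div, le_div_iff₀ hβ, mul_comm]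
  by_cases hq : q = 0
  · simpa [hq] using hk0
  refine InfSup.le_of_forall_le h hq (show 0 < ‖q‖ from norm_pos_iff.2 hq) (fun w hw => ?_) hk
  refine (gradNorm_nonneg _).lt_of_ne fun h0 => hw ?_
  exact Subtype.ext (eq_zero_of_gradNorm_eq_zero hd hΩb h0.symm)

theorem Spaces.InfSupM.norm_le (h : V.InfSupM P β) (hβ : 0 < β) (hk0 : 0 ≤ k) (ψ : V.Sh)
    (hk : ∀ K : V.Yh, bM P (ψ.1 : L2 Ω ℝ) K.1 ≤ k * divNorm K.1) : ‖ψ‖ ≤ 1 / β * k := by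
  rw [one_div_mul_eq_div, le_div_iff₀ hβ, mul_comm]
  by_cases hψ : ψ = 0
  · simpa [hψ] using hk0
  refine InfSup.le_of_forall_le h hψ (show 0 < ‖ψ‖ from norm_pos_iff.2 hψ)
    (fun w hw => ?_) hk
  refine (divNorm_nonneg _).lt_of_ne fun h0 => hw ?_
  exact Subtype.ext (eq_zero_of_divNorm_eq_zero h0.symm)

end infSup

theorem bM_zero_right (P : Params d) (ψ : L2 Ω ℝ) : bM P ψ (0 : SpY Ω) = 0 := by
  have : divY (0 : SpY Ω) = 0 := rfl
  rw [bM, this, inner_zero_right, mul_zero]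

theorem bS_zero_right (P : Params d) (q : L2 Ω ℝ) : bS P q (0 : SpX Ω) = 0 :=
  map_zero (bSLin P q)

theorem bS_zero_left (P : Params d) (v : SpX Ω) : bS P (0 : L2 Ω ℝ) v = 0 :=
  LinearMap.map_zero₂ (bSLin P) v

/-- The two inf-sup conditions bound the multipliers by the functional they induce. -/
theorem Spaces.norm_add_norm_le {P : Params d} (V : Spaces Ω) (hd : d = 2 ∨ d = 3)
    (hΩb : Bornology.IsBounded Ω) {βs βm : ℝ} (hβs : 0 < βs) (hβm : 0 < βm)
    (hinfs : V.InfSupS P βs) (hinfm : V.InfSupM P βm) {m : V.Eh × V.Sh} {k : ℝ} (hk : 0 ≤ k)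
    (h : ∀ v : V.Xh × V.Yh, |V.formBLin P m v| ≤ k * V.energySeminorm v) :
    ‖m.1‖ + ‖m.2‖ ≤ (1 / βs + 1 / βm) * k := by
  have hb : ∀ (v : V.Xh) (K : V.Yh), bS P (m.1.1 : L2 Ω ℝ) v.1 + bM P (m.2.1 : L2 Ω ℝ) K.1
      ≤ k * energyNorm v.1 K.1 := fun v K => by
    have h1 := (le_abs_self _).trans (h (v, K))
    rw [V.energySeminorm_apply] at h1
    exact h1
  -- Test pairs `(w, 0)` and `(0, K)` separate the two conditions, and on them the energy norm
  -- reduces to one of its parts.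
  have h1 : ∀ w : V.Xh, bS P (m.1.1 : L2 Ω ℝ) w.1 ≤ k * gradNorm w.1 := fun w => by
    have h2 := hb w 0
    rwa [Submodule.coe_zero, bM_zero_right, energyNorm_zero_right, add_zero] at h2
  have h2 : ∀ K : V.Yh, bM P (m.2.1 : L2 Ω ℝ) K.1 ≤ k * divNorm K.1 := fun K => by
    have h2 := hb 0 K
    rwa [Submodule.coe_zero, bS_zero_right, energyNorm_zero_left, zero_add] at h2
  rw [add_mul]
  exact add_le_add (hinfs.norm_le hd hΩb hβs hk m.1 h1) (hinfm.norm_le hβm hk m.2 h2)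

/-- Coercivity of `𝒜₀` on the pairs whose magnetic part is orthogonal to `S_h`. -/
theorem Spaces.coercive_formA0 {P : Params d} {V : Spaces Ω} (hκ : 0 < P.kappa)
    (hdiv : V.DivCompatible) (u : V.Xh) (J : V.Yh)
    (h : ∀ ψ : V.Sh, bM P (ψ.1 : L2 Ω ℝ) J.1 = 0) :
    cMin P * energyNorm u.1 J.1 ^ 2 ≤ formA0 P u.1 J.1 u.1 J.1 := by
  -- The choice `ψ = ∇·J` is admissible and yields `κ ‖∇·J‖² = 0`, so the `div` norm of `J` reduces
  -- to its `L²` norm.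
  obtain ⟨ψ, hψ, hψJ⟩ := hdiv J.1 J.2
  have h0 := h ⟨ψ, hψ⟩
  simp only [bM, hψJ, real_inner_self_eq_norm_sq] at h0
  have h1 : ‖divY J.1‖ ^ 2 = 0 := by simpa [hκ.ne'] using h0
  have h2 : cMin P ≤ P.Pr := min_le_left _ _
  have h3 : cMin P ≤ P.kappa := min_le_right _ _
  rw [energyNorm_sq, divNorm_sq, h1, add_zero, mul_add, formA0, aS, aM, gradNorm_sq]
  simp only [real_inner_self_eq_norm_sq]
  have h4 : 0 ≤ ∑ i, ‖grad (u.1 i)‖ ^ 2 := Finset.sum_nonneg fun _ _ => sq_nonneg _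
  have h5 := mul_le_mul_of_nonneg_right h2 h4
  have h6 := mul_le_mul_of_nonneg_right h3 (sq_nonneg ‖fld J.1‖)
  -- The terms `d(J, u)` and `-d(J, u)` cancel here.
  linarith

set_option maxHeartbeats 1600000 in
/-- The forms of the discrete problem. -/
theorem exists_coupledForms (hd : d = 2 ∨ d = 3) (hΩb : Bornology.IsBounded Ω)
    (P : Params d) (hPr : 0 < P.Pr) (hRa : 0 ≤ P.Ra) (hκ : 0 < P.kappa)
    (hdir : ‖P.dir‖ = 1) (hB : MemLp P.B 3 (volume.restrict Ω))
    (V : Spaces Ω) [FiniteDimensional ℝ V.Xh] [FiniteDimensional ℝ V.Yh]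
    (hdiv : V.DivCompatible) {βs βm : ℝ} (hβs : 0 < βs) (hβm : 0 < βm)
    (hinfs : V.InfSupS P βs) (hinfm : V.InfSupM P βm) :
    ∃ F : CoupledForms (V.Xh × V.Yh) (V.Eh × V.Sh) V.Zh,
      (∀ x y, F.A x y = formA0 P x.1.1 x.2.1 y.1.1 y.2.1) ∧
      (∀ x y z, F.c x y z = formA1 x.1.1 y.1.1 z.1.1) ∧
      (∀ m x, F.B m x = formB P m.1.1 m.2.1 x.1.1 x.2.1) ∧
      (∀ θ x, F.Q θ x = formQ P θ.1 x.1.1) ∧ (∀ θ r, F.e θ r = formE θ.1 r.1) ∧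
      (∀ x θ r, F.h x θ r = formH x.1.1 θ.1 r.1) ∧
      (∀ x, F.normW x = energyNorm x.1.1 x.2.1) ∧ (∀ m, F.normM m = ‖m.1‖ + ‖m.2‖) ∧
      (∀ θ, F.normZ θ = ‖grad θ.1‖) ∧ F.coer = cMin P ∧ F.bdc = lam2 Ω ∧ F.bdQ = lamQ Ω P ∧
      0 ≤ F.bdA ∧ 0 ≤ F.bdB := by
  have hdef : ∀ w, V.energySeminorm w = 0 → w = 0 := fun w hw => by
    rw [V.energySeminorm_apply] at hw
    obtain ⟨h1, h2⟩ := eq_zero_of_energyNorm_eq_zero hd hΩb hw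
    exact Prod.ext (Subtype.ext h1) (Subtype.ext h2)
  -- A bound for `𝒜₀` from finite dimension suffices: it enters only the multiplier estimate, not
  -- the contraction factor or the stated bounds.
  obtain ⟨a, ha0, ha⟩ := Seminorm.exists_bilinear_bound (W := V.Xh × V.Yh) V.energySeminorm hdef
    (V.formA0Lin P hd hΩb hB)
  have hlam := (lam2_spec (Ω := Ω) hd hΩb).1
  have hQ : 0 ≤ lamQ Ω P := mul_nonneg (mul_nonneg hPr.le hRa) (sq_nonneg _)
  refine ⟨{
    A := V.formA0Lin P hd hΩb hB
    c := V.formA1Lin hd hΩb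
    B := V.formBLin P
    Q := V.formQLin P
    e := V.formELin
    h := V.formHLin hd hΩb
    normW := V.energySeminorm
    normM := fun m => ‖m.1‖ + ‖m.2‖
    normZ := fun z => ‖grad z.1‖
    coer := cMin P
    bdA := a
    bdB := 1 / βs + 1 / βm
    bdc := lam2 Ω
    bdQ := lamQ Ω P
    coer_pos := lt_min hPr hκ
    bdc_nonneg := hlam
    bdQ_nonneg := hQ
    normW_def := hdef
    normM_def := fun m hm => ?_
    normZ_nonneg := fun z => norm_nonneg _
    normZ_def := fun z hz => ?_
    coercive := fun w hw => ?_
    A_le := ha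
    c_self := fun w u => ?_
    c_le := fun w u v => ?_
    Q_le := fun z v => ?_
    e_self := fun z => real_inner_self_eq_norm_sq (grad z.1)
    h_self := fun w z => sub_self _
    h_le := fun w z r => ?_
    infSup := fun m k hk h => ?_ }, fun _ _ => rfl, V.formA1Lin_apply hd hΩb, fun _ _ => rfl, fun _ _ => rfl, fun _ _ => rfl,
    fun _ _ _ => rfl, V.energySeminorm_apply, fun _ => rfl, fun _ => rfl, rfl, rfl, rfl,
    ha0, by positivity⟩
  · exact Prod.ext (norm_le_zero_iff.1 ((le_add_of_nonneg_right (norm_nonneg m.2)).trans hm))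
      (norm_le_zero_iff.1 ((le_add_of_nonneg_left (norm_nonneg m.1)).trans hm))
  · have := norm_le_norm_grad hd hΩb z.1
    rw [hz, mul_zero] at this
    exact Subtype.ext (norm_le_zero_iff.1 this)
  · rw [V.energySeminorm_apply]
    refine V.coercive_formA0 hκ hdiv w.1 w.2 fun ψ => ?_
    have h := hw (0, ψ)
    change bS P (0 : L2 Ω ℝ) w.1.1 + bM P (ψ.1 : L2 Ω ℝ) w.2.1 = 0 at h
    rwa [bS_zero_left, zero_add] at h
  · rw [V.formA1Lin_apply]
    exact sub_self _
  · simp only [V.formA1Lin_apply, V.energySeminorm_apply]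
    have h1 := gradNorm_nonneg w.1.1
    have h2 := gradNorm_nonneg u.1.1
    have h3 := gradNorm_nonneg v.1.1
    have h4 := energyNorm_nonneg w.1.1 w.2.1
    have h5 := energyNorm_nonneg u.1.1 u.2.1
    refine (abs_formA1_le hd hΩb _ _ _).trans ?_
    gcongr <;> exact gradNorm_le_energyNorm _ _
  · rw [V.energySeminorm_apply]
    refine (abs_formQ_le P hd hΩb hPr hRa hdir z.1 v.1.1).trans ?_
    gcongr
    exact gradNorm_le_energyNorm _ _
  · rw [V.energySeminorm_apply]
    refine (abs_formH_le hd hΩb w.1.1 z.1 r.1).trans ?_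
    gcongr
    exact gradNorm_le_energyNorm _ _
  · exact V.norm_add_norm_le hd hΩb hβs hβm hinfs hinfm hk h

end IMHD
end

/-! ### Well-posedness and the bounds of the solution -/

noncomputable section

namespace IMHD

/-- Solutions of the discrete problem are the solutions linearized at themselves. -/
theorem isSolution_iff_isOseen {d : ℕ} {Ω : Set (Pt d)} {P : Params d} {V : Spaces Ω}
    {F : CoupledForms (V.Xh × V.Yh) (V.Eh × V.Sh) V.Zh}
    (hA : ∀ x y, F.A x y = formA0 P x.1.1 x.2.1 y.1.1 y.2.1)
    (hc : ∀ x y z, F.c x y z = formA1 x.1.1 y.1.1 z.1.1)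
    (hB : ∀ m x, F.B m x = formB P m.1.1 m.2.1 x.1.1 x.2.1)
    (hQ : ∀ θ x, F.Q θ x = formQ P θ.1 x.1.1) (he : ∀ θ r, F.e θ r = formE θ.1 r.1)
    (hh : ∀ x θ r, F.h x θ r = formH x.1.1 θ.1 r.1) (D : Source Ω) (s : State V) :
    IsSolution P D V s ↔
      F.IsOseen (s.u, s.J) (V.formLLin P D) (V.heatLin D) (s.u, s.J) (s.p, s.pot) s.temp := by
  refine Iff.trans ?_ (CoupledForms.isOseen_iff hA hc hB hQ he hh).symm
  exact and_congr ⟨fun h v => h v.1 v.2, fun h v K => h (v, K)⟩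
    (and_congr_left' ⟨fun h m => h m.1 m.2, fun h q ψ => h (q, ψ)⟩)

set_option maxHeartbeats 1600000 in
/-- The conclusion of the main theorem, from the abstract theory of `CoupledForms`. -/
theorem wellPosed_and_bounds {d : ℕ} {Ω : Set (Pt d)} (hd : d = 2 ∨ d = 3)
    (hΩb : Bornology.IsBounded Ω)
    (P : Params d) (hPr : 0 < P.Pr) (hRa : 0 ≤ P.Ra) (hκ : 0 < P.kappa)
    (hdir : ‖P.dir‖ = 1) (hB : MemLp P.B 3 (volume.restrict Ω))
    (V : Spaces Ω) (hV : V.IsFinite) (hdiv : V.DivCompatible)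
    {βs βm : ℝ} (hβs : 0 < βs) (hβm : 0 < βm)
    (hinfs : V.InfSupS P βs) (hinfm : V.InfSupM P βm)
    (D : Source Ω) (hσ : sigma P D < 1) :
    WellPosed P D V ∧
    ∀ s : State V, IsSolution P D V s →
      energyNorm s.u.1 s.J.1 ≤ (normL P D + lamQ Ω P * lamPsi D) / cMin P ∧
      ‖grad s.temp.1‖ ≤ lamPsi D := by
  obtain ⟨_, _, _, _, _⟩ := hV
  obtain ⟨F, hA, hc, hBf, hQ, he, hh, hW, hM, hZ, hcoer, hbdc, hbdQ, hbdA, hbdB⟩ :=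
    exists_coupledForms hd hΩb P hPr hRa hκ hdir hB V hdiv hβs hβm hinfs hinfm
  have hsol : ∀ (D' : Source Ω) (s : State V), IsSolution P D' V s ↔
      F.IsOseen (s.u, s.J) (V.formLLin P D') (V.heatLin D') (s.u, s.J) (s.p, s.pot) s.temp :=
    isSolution_iff_isOseen hA hc hBf hQ he hh
  have hl : 0 ≤ normL P D := Real.sqrt_nonneg _
  have ht : 0 ≤ lamPsi D := (dualNormZ_spec hd hΩb D.heat).1
  have hL : ∀ v, |V.formLLin P D v| ≤ normL P D * F.normW v := fun v => by
    rw [hW]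
    exact abs_formL_le_normL P D hd hΩb hκ _ _
  have hφ : ∀ r, |V.heatLin D r| ≤ lamPsi D * F.normZ r := fun r => by
    rw [hZ]
    exact (dualNormZ_spec hd hΩb D.heat).2 r.1
  have hk : F.factor (normL P D) (lamPsi D) < 1 := by
    have hC : 0 < cMin P := lt_min hPr hκ
    have hlam := (lam2_spec (Ω := Ω) hd hΩb).1
    -- The last term of `σ`: the contraction factor is the sum of the other three.
    have h0 : 0 ≤ lam2 Ω * normL P D / cMin P := by positivity
    rw [CoupledForms.factor, hcoer, hbdc, hbdQ]
    calc _ = lam2 Ω * normL P D / cMin P ^ 2 + lam2 Ω * lamQ Ω P * lamPsi D / cMin P ^ 2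
          + lam2 Ω * lamQ Ω P * lamPsi D / cMin P := by field_simp
      _ ≤ sigma P D := by rw [sigma]; linarith
      _ < 1 := hσ
  have hM0 : ∀ m, 0 ≤ F.normM m := fun m => by rw [hM]; positivity
  refine ⟨⟨?_, fun s hs ε hε => ?_⟩, fun s hs => ?_⟩
  · obtain ⟨w, m, z, H⟩ := F.exists_isOseen_self hbdA hl ht hL hφ hk
    refine ⟨⟨w.1, w.2, m.1, m.2, z⟩, (hsol D _).2 H, fun s hs => ?_⟩
    obtain ⟨h1, h2, h3⟩ := CoupledForms.isOseen_self_unique hbdA hbdB hl ht hL hφ hk hM0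
      ((hsol D s).1 hs) H
    subst h1 h2 h3
    rfl
  · obtain ⟨c, hc0, hcs⟩ :=
      CoupledForms.exists_normW_sub_le hbdA hbdB ((hsol D s).1 hs) hl ht hL hφ hk
    -- The Lipschitz estimate requires `a ≤ 1`; dividing by `c + 1` gives `c * a < ε` even when `c =
    -- 0`.
    set a : ℝ := min 1 (ε / (c + 1)) with ha
    have ha0 : 0 < a := lt_min one_pos (by positivity)
    have hca : c * a < ε := by
      have h1 : a ≤ ε / (c + 1) := min_le_right _ _
      rw [le_div_iff₀ (by positivity)] at h1
      linarith
    -- Perturbing `f` and `g` by less than `δ` changes `L` by at most `(1 + κ) δ` in the dual of the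
    -- energy norm, which is to be `a`.
    refine ⟨a / (1 + P.kappa), by positivity, fun D' hf hg hheat s' hs' => ?_⟩
    have hδ : a / (1 + P.kappa) * (1 + P.kappa) = a := by field_simp
    have hδ0 : 0 ≤ a / (1 + P.kappa) := by positivity
    refine lt_of_le_of_lt ?_ hca
    have h := hcs a ha0.le (min_le_left _ _) _ _ _ _ _ ((hsol D' s').1 hs') (fun v => ?_)
      (fun r => ?_)
    · rw [hW, hM, hZ, ← add_assoc] at h
      exact h
    · rw [V.formLLin_sub_apply, hW]
      refine (abs_formL_le P _ hd hΩb hκ _ _).trans ?_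
      have h1 := gradNorm_le_energyNorm v.1.1 v.2.1
      have h2 := divNorm_le_energyNorm v.1.1 v.2.1
      have h3 := gradNorm_nonneg v.1.1
      have h4 := divNorm_nonneg v.2.1
      calc _ ≤ a / (1 + P.kappa) * energyNorm v.1.1 v.2.1
            + P.kappa * (a / (1 + P.kappa)) * energyNorm v.1.1 v.2.1 := by gcongr
        _ = a / (1 + P.kappa) * (1 + P.kappa) * energyNorm v.1.1 v.2.1 := by ring
        _ = _ := by rw [hδ]
    · rw [hZ]
      refine ((dualNormZ_spec hd hΩb (D'.heat - D.heat)).2 r.1).trans ?_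
      have h1 : dualNormZ (D'.heat - D.heat) ≤ a := by nlinarith
      gcongr
  · have H := (hsol D s).1 hs
    have h1 := H.normW_le hl ht hL hφ
    have h2 := H.normZ_le ht hφ
    rw [hW, hbdQ, hcoer] at h1
    rw [hZ] at h2
    exact ⟨h1, h2⟩

end IMHD
end

theorem theorem3p3 {d : ℕ} (hd : d = 2 ∨ d = 3)
    (Ω : Set (IMHD.Pt d)) (hΩo : IsOpen Ω) (hΩc : IsConnected Ω) (hΩb : Bornology.IsBounded Ω)
    (P : IMHD.Params d) (hPr : 0 < P.Pr) (hRa : 0 ≤ P.Ra) (hκ : 0 < P.kappa)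
    (hdir : ‖P.dir‖ = 1) (hB : MemLp P.B 3 (volume.restrict Ω))
    (V : IMHD.Spaces Ω) (hV : V.IsFinite) (hdiv : V.DivCompatible)
    (βs βm : ℝ) (hβs : 0 < βs) (hβm : 0 < βm)
    (hinfs : V.InfSupS P βs) (hinfm : V.InfSupM P βm)
    (D : IMHD.Source Ω) (hσ : IMHD.sigma P D < 1) :
    IMHD.WellPosed P D V ∧
    ∀ s : IMHD.State V, IMHD.IsSolution P D V s →
      IMHD.energyNorm s.u.1 s.J.1
          ≤ (IMHD.normL P D + IMHD.lamQ Ω P * IMHD.lamPsi D) / IMHD.cMin P ∧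
      ‖IMHD.grad s.temp.1‖ ≤ IMHD.lamPsi D :=
  IMHD.wellPosed_and_bounds hd hΩb P hPr hRa hκ hdir hB V hV hdiv hβs hβm hinfs hinfm D hσ
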